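/- **Setting.** On $\mathbb{R}^8\setminus 0$ with coordinates $x_0,\dots,x_7$ and Euclidean metric $e$, write $\mathbb{R}^8=\mathbb{H}^2$ with quaternionic coordinates $q_0=x_0+x_1i+x_2j+x_3k$, $q_1=x_4+x_5i+x_6j+x_7k$. Let $R=\sum_i x_i^2$, let $Y_1,Y_2,Y_3$ be the vector fields generating right multiplication by $e^{it},e^{jt},e^{kt}$, let $X$ be the vector field generating left multiplication by $e^{it}$, and put $\hat\alpha_i=R^{-1}e(Y_i,\cdot)$. The conical $G_2$ structure on $\mathbb{R}^+\times\mathbb{CP}^3=(\mathbb{R}^8\setminus0)/\langle Y_1\rangle$, pulled back to $\mathbb{R}^8\setminus 0$, has 3-form and metric $$\varphi=d\big(\tfrac13R^3\omega\big),\quad \omega=d\hat\alpha_1+3\,\hat\alpha_2\wedge\hat\alpha_3,\qquad h_2=dR^2+R^2\big(s_4+\hat\alpha_2^2+\hat\alpha_3^2\big),$$ where $s_4=2\big(R^{-1}e-\tfrac14R^{-2}dR^2-\hat\alpha_1^2-\hat\alpha_2^2-\hat\alpha_3^2\big)$. The quotient by the circle action generated by $X$ is realised by $Q\colon\mathbb{R}^8\setminus0\to\mathbb{R}^3\times\mathbb{R}^3$,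 $Q(x)=(\mathbf{u},\mathbf{v})$, with $$\mathbf{u}=\big(x_0^2+x_1^2-x_4^2-x_5^2,\;2(x_0x_4+x_1x_5),\;2(x_0x_5-x_1x_4)\big),$$ $$\mathbf{v}=\big(x_2^2+x_3^2-x_6^2-x_7^2,\;2(x_2x_6+x_3x_7),\;2(x_2x_7-x_3x_6)\big).$$ Let $u=|\mathbf{u}|$, $v=|\mathbf{v}|$, $N_2=6uv-2\,\mathbf{u}\cdot\mathbf{v}$, and let $M=\{(\mathbf{u},\mathbf{v}):uv\neq0\}$. The induced tensors $g_2,\sigma,\mathbb{J}$ on $M$ are determined by $$Q^*\sigma=X\lrcorner\,\varphi,\qquad h_2=Q^*g_2+\tfrac14h_2(X,X)\,\Theta_2\otimes\Theta_2,\quad \Theta_2=\tfrac{2}{h_2(X,X)}\,X\lrcorner\,h_2,$$ $$\sigma(W,Z)=h_2(X,X)^{1/2}\,g_2(\mathbb{J}W,Z).$$ **Triple products.** For triples $\mathbf{A},\mathbf{B},\mathbf{C}$ of functions or 1-forms, $\{\mathbf{A},\mathbf{B},\mathbf{C}\}=\sum_{s\in S_3}\mathrm{sgn}(s)\,A_{s(1)}\wedge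 B_{s(2)}\wedge C_{s(3)}$ (six terms, and $(a\wedge b)(x,y)=a(x)b(y)-a(y)b(x)$ for 1-forms). For an expression $P$ in $\mathbf{u},\mathbf{v},u,v$ and their differentials, $\widetilde P$ denotes $P$ with $\mathbf{u},\mathbf{v}$ (and $u,v$) interchanged. **Theorem.** Tensors $g_2,\sigma,\mathbb{J}$ as above exist on $M$, $\mathbb{J}^2=-1$, and the $(3,0)$-forms on $(M,\mathbb{J})$, i.e. the complex 3-forms $T$ with $T(\mathbb{J}\,\cdot,\cdot,\cdot)=i\,T$, are generated by the smooth, nowhere zero form $\Psi=\psi^++i\psi^-$, where $8uv\,\psi^+=P+\widetilde P$ and $4N_2^{1/2}\,\psi^-=S-\widetilde S$ with $$\begin{aligned}P={}&\tfrac16v(N_2+4v^2)\{d\mathbf{u},d\mathbf{u},d\mathbf{u}\}-v(4u^2+3uv+\mathbf{u}\cdot\mathbf{v})\{d\mathbf{v},d\mathbf{u},d\mathbf{u}\}\\&+\big((u+2v)\,\mathbf{v}\cdot d\mathbf{v}+v\,\mathbf{u}\cdot d\mathbf{v}\big)\wedge\{\mathbf{u},d\mathbf{u},d\mathbf{u}\}+\big(v\,\mathbf{u}\cdot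 d\mathbf{v}-u\,\mathbf{v}\cdot d\mathbf{v}\big)\wedge\{\mathbf{v},d\mathbf{u},d\mathbf{u}\},\end{aligned}$$ $$\begin{aligned}S={}&\tfrac13(N_2+4v^2)\{d\mathbf{u},d\mathbf{u},d\mathbf{u}\}+\big((3+uv^{-1})\,\mathbf{u}\cdot\mathbf{v}-3u^2-5uv\big)\{d\mathbf{u},d\mathbf{v},d\mathbf{v}\}\\&+2\,\mathbf{v}\cdot d\mathbf{v}\wedge\{\mathbf{u},d\mathbf{u},d\mathbf{u}\}+2uv^{-1}\,\mathbf{v}\cdot d\mathbf{u}\wedge\{\mathbf{v},d\mathbf{v},d\mathbf{v}\}\\&+\big((1-uv^{-1})\,\mathbf{v}\cdot d\mathbf{v}+(3+vu^{-1})\,\mathbf{u}\cdot d\mathbf{v}\big)\wedge\{\mathbf{v},d\mathbf{u},d\mathbf{u}\}.\end{aligned}$$ That is, at every $m\in M$ the space of $(3,0)$-forms on $T_mM$ is the complex line spanned by $\Psi_m\neq0$, and a complex 3-form $T$ on $M$ is a smooth $(3,0)$-form if and only if $T=f\,\Psi$ for some smooth function $f\colon M\to\mathbb{C}$. -/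

import Mathlib

open scoped ContDiff

noncomputable section

namespace G2CircleQuotient

/-! ### Exterior algebra -/

section Exterior

variable {E F : Type*} [NormedAddCommGroup E] [NormedSpace ℝ E]
  [NormedAddCommGroup F] [NormedSpace ℝ F]

/-- A covector, regarded as an alternating `1`-form. -/
def oneForm (a : E →L[ℝ] ℝ) : E [⋀^Fin 1]→L[ℝ] ℝ :=
  ContinuousAlternatingMap.ofSubsingleton ℝ E ℝ 0 a

/-- The wedge product `a ∧ b` of a covector `a` and an `n`-form `b`:
`(a ∧ b) (v₀, …, vₙ) = ∑ i, (-1) ^ i * a (vᵢ) * b (v₀, …, v̂ᵢ, …, vₙ)`. -/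
def wedge {n : ℕ} (a : E →L[ℝ] ℝ) (b : E [⋀^Fin n]→L[ℝ] F) : E [⋀^Fin (n + 1)]→L[ℝ] F :=
  ContinuousAlternatingMap.alternatizeUncurryFin (a.smulRight b)

theorem wedge_apply {n : ℕ} (a : E →L[ℝ] ℝ) (b : E [⋀^Fin n]→L[ℝ] F) (v : Fin (n + 1) → E) :
    wedge a b v = ∑ i : Fin (n + 1), (-1 : ℤ) ^ (i : ℕ) • (a (v i) • b (i.removeNth v)) := by
  simp [wedge, ContinuousAlternatingMap.alternatizeUncurryFin_apply]

/-- The complex form `p + i q` with real part `p` and imaginary part `q`. -/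
def complexForm {n : ℕ} (p q : E [⋀^Fin n]→L[ℝ] ℝ) : E [⋀^Fin n]→L[ℝ] ℂ :=
  Complex.ofRealCLM.compContinuousAlternatingMap p +
    Complex.I • Complex.ofRealCLM.compContinuousAlternatingMap q

/-- The complex `n`-forms of type `(n, 0)` with respect to an endomorphism `J` of the tangent
space (an almost complex structure): the alternating real-multilinear complex-valued forms that
are complex-linear in each argument, `J` acting as multiplication by `i`. -/
def formsOfTypeZero (n : ℕ) (J : E →L[ℝ] E) : Submodule ℂ (E [⋀^Fin n]→L[ℝ] ℂ) where
  carrier := {T | ∀ (v : Fin n → E) (k : Fin n),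
    T (Function.update v k (J (v k))) = Complex.I * T v}
  zero_mem' := by intro v k; simp
  add_mem' := by
    intro S T hS hT v k
    simp [hS v k, hT v k, mul_add]
  smul_mem' := by
    intro c T hT v k
    simp [hT v k, mul_left_comm]

end Exterior

/-! ### The conical `G₂` structure, pulled back to `ℝ⁸` minus the origin

Tensors on `ℝ⁺ × ℂP³ = (ℝ⁸ ∖ 0) / U(1)`, the circle being generated by `Y₁`, are written as
tensors on `ℝ⁸ ∖ 0`. -/

/-- `ℝ⁸` with its Euclidean metric. -/
abbrev V8 : Type := EuclideanSpace ℝ (Fin 8)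

/-- `ℝ³` with its Euclidean metric. -/
abbrev V3 : Type := EuclideanSpace ℝ (Fin 3)

/-- Bivectors `(𝐮, 𝐯)`, i.e. `ℝ⁶ = ℝ³ × ℝ³`. -/
abbrev Bivector : Type := V3 × V3

/-- The Euclidean norm squared. -/
def R (x : V8) : ℝ := ‖x‖ ^ 2

/-- The differential of `R`. -/
def dR (x : V8) : V8 →L[ℝ] ℝ := fderiv ℝ R x

/-- Generator of right multiplication by `exp (i t)` on `ℍ²`. -/
def Y1 (x : V8) : V8 := !₂[-x 1, x 0, x 3, -x 2, -x 5, x 4, x 7, -x 6]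

/-- Generator of right multiplication by `exp (j t)` on `ℍ²`. -/
def Y2 (x : V8) : V8 := !₂[-x 2, -x 3, x 0, x 1, -x 6, -x 7, x 4, x 5]

/-- Generator of right multiplication by `exp (k t)` on `ℍ²`. -/
def Y3 (x : V8) : V8 := !₂[-x 3, x 2, -x 1, x 0, -x 7, x 6, -x 5, x 4]

/-- Generator of left multiplication by `exp (i t)` on `ℍ²`. -/
def X (x : V8) : V8 := !₂[-x 1, x 0, -x 3, x 2, -x 5, x 4, -x 7, x 6]

/-- The scale-invariant `1`-form `R⁻¹ e(Y, ·)`, with `e` the Euclidean metric. -/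
def hatForm (Y : V8 → V8) (x : V8) : V8 →L[ℝ] ℝ := (R x)⁻¹ • innerSL ℝ (Y x)

/-- The nearly Kähler `2`-form `ω = dα̂₁ + 3 α̂₂ ∧ α̂₃` of `ℂP³`. -/
def omega (x : V8) : V8 [⋀^Fin 2]→L[ℝ] ℝ :=
  extDeriv (fun y => oneForm (hatForm Y1 y)) x +
    (3 : ℝ) • wedge (hatForm Y2 x) (oneForm (hatForm Y3 x))

/-- The `G₂` form `φ = d (R³ ω / 3)` of the cone over the nearly Kähler `ℂP³`. -/
def phi (x : V8) : V8 [⋀^Fin 3]→L[ℝ] ℝ :=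
  extDeriv (fun y => (R y ^ 3 / 3) • omega y) x

/-- The pullback of the metric of `S⁴`: twice the round metric
`R⁻¹ e - (4 R²)⁻¹ dR²` of the unit `S⁷` with its part along the `Sp(1)` orbits removed. -/
def sphereMetric (x v w : V8) : ℝ :=
  2 * ((R x)⁻¹ * inner ℝ v w - (4 * R x ^ 2)⁻¹ * (dR x v * dR x w) -
    (hatForm Y1 x v * hatForm Y1 x w + hatForm Y2 x v * hatForm Y2 x w +
      hatForm Y3 x v * hatForm Y3 x w))

/-- The nearly Kähler metric of `ℂP³`. -/
def nearlyKahlerMetric (x v w : V8) : ℝ :=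
  sphereMetric x v w + hatForm Y2 x v * hatForm Y2 x w + hatForm Y3 x v * hatForm Y3 x w

/-- The conical metric `h₂ = dR² + R² ĥ₂` with holonomy `G₂`. -/
def coneMetric (x v w : V8) : ℝ :=
  dR x v * dR x w + R x ^ 2 * nearlyKahlerMetric x v w

/-- The connection form `Θ₂ = (2 / h₂(X, X)) h₂(X, ·)`. -/
def Theta (x v : V8) : ℝ := 2 / coneMetric x (X x) (X x) * coneMetric x (X x) v

/-! ### The quotient by the circle generated by `X` -/

/-- The quadratic map realising the quotient `ℝ⁸ → ℝ⁸ / (U(1) × U(1)) ≅ ℝ⁶`. -/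
def Q (x : V8) : Bivector :=
  (!₂[x 0 ^ 2 + x 1 ^ 2 - x 4 ^ 2 - x 5 ^ 2, 2 * (x 0 * x 4 + x 1 * x 5),
      2 * (x 0 * x 5 - x 1 * x 4)],
   !₂[x 2 ^ 2 + x 3 ^ 2 - x 6 ^ 2 - x 7 ^ 2, 2 * (x 2 * x 6 + x 3 * x 7),
      2 * (x 2 * x 7 - x 3 * x 6)])

/-- The smooth locus `uv ≠ 0` of the quotient. -/
def smoothLocus : Set Bivector := {m | m.1 ≠ 0 ∧ m.2 ≠ 0}

/-- `g`, `σ`, `J` are the tensors induced on the smooth locus of the quotient from the conical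
`G₂` structure:
`Q^* σ = X ⌟ φ`, `h₂ = Q^* g + (h₂(X, X) / 4) Θ₂ ⊗ Θ₂`, and
`σ(W, Z) = h₂(X, X) ^ (1/2) g(J W, Z)`. -/
structure IsInducedStructure (g : Bivector → Bivector →L[ℝ] Bivector →L[ℝ] ℝ)
    (σ : Bivector → Bivector [⋀^Fin 2]→L[ℝ] ℝ) (J : Bivector → Bivector →L[ℝ] Bivector) :
    Prop where
  pullback_sigma : ∀ x : V8, Q x ∈ smoothLocus →
    (σ (Q x)).compContinuousLinearMap (fderiv ℝ Q x) = (phi x).curryLeft (X x)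
  pullback_metric : ∀ x : V8, Q x ∈ smoothLocus → ∀ v w : V8,
    coneMetric x v w = g (Q x) (fderiv ℝ Q x v) (fderiv ℝ Q x w) +
      1 / 4 * coneMetric x (X x) (X x) * (Theta x v * Theta x w)
  sigma_eq : ∀ x : V8, Q x ∈ smoothLocus → ∀ W Z : Bivector,
    σ (Q x) ![W, Z] = √(coneMetric x (X x) (X x)) * g (Q x) (J (Q x) W) Z

/-! ### Triple products and the `3`-form `Ψ` -/

/-- The coordinate `1`-forms `du₁, du₂, du₃`. -/
def du (i : Fin 3) : Bivector →L[ℝ] ℝ :=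
  (EuclideanSpace.proj i : V3 →L[ℝ] ℝ).comp (ContinuousLinearMap.fst ℝ V3 V3)

/-- The coordinate `1`-forms `dv₁, dv₂, dv₃`. -/
def dv (i : Fin 3) : Bivector →L[ℝ] ℝ :=
  (EuclideanSpace.proj i : V3 →L[ℝ] ℝ).comp (ContinuousLinearMap.snd ℝ V3 V3)

/-- The `1`-form `𝐚 · dB`. -/
def dot (a : V3) (dB : Fin 3 → Bivector →L[ℝ] ℝ) : Bivector →L[ℝ] ℝ := ∑ i, a i • dB i

/-- The triple product `{𝐚, dB, dC}`, a `2`-form with `3! = 6` terms. -/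
def triple2 (a : V3) (dB dC : Fin 3 → Bivector →L[ℝ] ℝ) : Bivector [⋀^Fin 2]→L[ℝ] ℝ :=
  ∑ s : Equiv.Perm (Fin 3),
    (Equiv.Perm.sign s : ℤ) • (a (s 0) • wedge (dB (s 1)) (oneForm (dC (s 2))))

/-- The triple product `{dA, dB, dC}`, a `3`-form with `3! = 6` terms. -/
def triple3 (dA dB dC : Fin 3 → Bivector →L[ℝ] ℝ) : Bivector [⋀^Fin 3]→L[ℝ] ℝ :=
  ∑ s : Equiv.Perm (Fin 3),
    (Equiv.Perm.sign s : ℤ) • wedge (dA (s 0)) (wedge (dB (s 1)) (oneForm (dC (s 2))))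

/-- `N₂ = 6 u v - 2 𝐮 · 𝐯`. -/
def N2 (a b : V3) : ℝ := 6 * ‖a‖ * ‖b‖ - 2 * inner ℝ a b

/-- The displayed part of `8 u v ψ⁺`; here `(a, b, da, db)` stands for `(𝐮, 𝐯, d𝐮, d𝐯)` and
the part obtained by interchanging `𝐮` and `𝐯` is to be added. -/
def psiPlusPart (a b : V3) (da db : Fin 3 → Bivector →L[ℝ] ℝ) : Bivector [⋀^Fin 3]→L[ℝ] ℝ :=
  (1 / 6 * ‖b‖ * (N2 a b + 4 * ‖b‖ ^ 2)) • triple3 da da da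
  - (‖b‖ * (4 * ‖a‖ ^ 2 + 3 * ‖a‖ * ‖b‖ + inner ℝ a b)) • triple3 db da da
  + wedge ((‖a‖ + 2 * ‖b‖) • dot b db + ‖b‖ • dot a db) (triple2 a da da)
  + wedge (‖b‖ • dot a db - ‖a‖ • dot b db) (triple2 b da da)

/-- The displayed part of `4 N₂ ^ (1/2) ψ⁻`; here `(a, b, da, db)` stands for `(𝐮, 𝐯, d𝐮, d𝐯)`
and the part obtained by interchanging `𝐮` and `𝐯` is to be subtracted. -/
def psiMinusPart (a b : V3) (da db : Fin 3 → Bivector →L[ℝ] ℝ) : Bivector [⋀^Fin 3]→L[ℝ] ℝ :=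
  (1 / 3 * (N2 a b + 4 * ‖b‖ ^ 2)) • triple3 da da da
  + ((3 + ‖a‖ * ‖b‖⁻¹) * inner ℝ a b - 3 * ‖a‖ ^ 2 - 5 * ‖a‖ * ‖b‖) • triple3 da db db
  + (2 : ℝ) • wedge (dot b db) (triple2 a da da)
  + (2 * ‖a‖ * ‖b‖⁻¹) • wedge (dot b da) (triple2 b db db)
  + wedge ((1 - ‖a‖ * ‖b‖⁻¹) • dot b db + (3 + ‖b‖ * ‖a‖⁻¹) • dot a db) (triple2 b da da)

/-- The real `3`-form `ψ⁺`. -/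
def psiPlus (m : Bivector) : Bivector [⋀^Fin 3]→L[ℝ] ℝ :=
  (8 * ‖m.1‖ * ‖m.2‖)⁻¹ • (psiPlusPart m.1 m.2 du dv + psiPlusPart m.2 m.1 dv du)

/-- The real `3`-form `ψ⁻`. -/
def psiMinus (m : Bivector) : Bivector [⋀^Fin 3]→L[ℝ] ℝ :=
  (4 * √(N2 m.1 m.2))⁻¹ • (psiMinusPart m.1 m.2 du dv - psiMinusPart m.2 m.1 dv du)

/-- The complex `3`-form `Ψ = ψ⁺ + i ψ⁻`. -/
def Psi (m : Bivector) : Bivector [⋀^Fin 3]→L[ℝ] ℂ := complexForm (psiPlus m) (psiMinus m)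

end G2CircleQuotient

end

open G2CircleQuotient

open scoped ContDiff

noncomputable section

namespace G2CircleQuotient

/-! ### Exterior algebra: evaluation and smoothness of wedge products. -/

section Exterior

variable {E F : Type*} [NormedAddCommGroup E] [NormedSpace ℝ E]
  [NormedAddCommGroup F] [NormedSpace ℝ F]

/-! Put z = (x₀ + ix₁, x₄ + ix₅) and w = (x₂ + ix₃, x₆ + ix₇). Then `Q` is a pair of Hopf maps, 𝐮 =
z*σz and 𝐯 = w*σw with Pauli matrices σ, and u = |z|², v = |w|², so the norms and their
differentials pull back to polynomials. The equation for the induced 2-form thus becomes a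
polynomial identity (`sigma_dQ`). For the metric, let θ_z, θ_w be the angular forms of the two
spinors, S = θ_z/u + θ_w/v and D = d𝐯/2v − d𝐮/2u. The angular forms enter h₂ only through S, and
Fierz identities give h₂(X, ·) = (N₂/2) S + det(𝐮, 𝐯, D). Subtracting the square of this form
divided by N₂ removes S and leaves g₂ (`coneMetric_eq`).

The endomorphism `rot` = √N₂ 𝕁 satisfies g₂(rot W, Z) = σ(W, Z) and rot² = −N₂ (`metric_rot`,
`rot_rot`). As `Q` covers M and its differential is onto there, g₂ and σ are determined on M. As σ
is nondegenerate, so is g₂, and 𝕁 is determined as well (`IsInducedStructure.eq_complexStructure`).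

Ψ has type (3,0) once ψ⁺(𝕁W, ·, ·) = −ψ⁻(W, ·, ·), since the companion identity follows from 𝕁² =
−1. Both sides are built from scalar and triple products, so a rotation reduces the check to 𝐮 on an
axis and 𝐯 in a coordinate plane (`scaledPlus_rot_normalForm`). In real dimension six one nonzero
(3,0)-form spans all of them (`formsOfTypeZero_eq_span`), and the coefficient in T = fΨ is locally a
quotient T(w)/Ψ(w), hence smooth. -/

@[simp]
theorem oneForm_apply (a : E →L[ℝ] ℝ) (v : Fin 1 → E) : oneForm a v = a (v 0) := rfl

theorem wedge_oneForm_apply (a b : E →L[ℝ] ℝ) (v : Fin 2 → E) :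
    wedge a (oneForm b) v = a (v 0) * b (v 1) - a (v 1) * b (v 0) := by
  simp [wedge_apply, Fin.sum_univ_succ, Fin.removeNth]
  ring

theorem wedge_apply_three (a : E →L[ℝ] ℝ) (b : E [⋀^Fin 2]→L[ℝ] ℝ) (v : Fin 3 → E) :
    wedge a b v = a (v 0) * b ![v 1, v 2] - a (v 1) * b ![v 0, v 2] + a (v 2) * b ![v 0, v 1] := by
  have h0 : (0 : Fin 3).removeNth v = ![v 1, v 2] := by ext i; fin_cases i <;> rfl
  have h1 : (1 : Fin 3).removeNth v = ![v 0, v 2] := by ext i; fin_cases i <;> rfl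
  have h2 : (2 : Fin 3).removeNth v = ![v 0, v 1] := by ext i; fin_cases i <;> rfl
  rw [wedge_apply, Fin.sum_univ_three, h0, h1, h2]
  simp
  ring

theorem contDiffWithinAt_wedge {G : Type*} [NormedAddCommGroup G] [NormedSpace ℝ G] {n : ℕ}
    {k : WithTop ℕ∞} {a : G → E →L[ℝ] ℝ} {b : G → E [⋀^Fin n]→L[ℝ] F} {s : Set G} {x : G}
    (ha : ContDiffWithinAt ℝ k a s x) (hb : ContDiffWithinAt ℝ k b s x) :
    ContDiffWithinAt ℝ k (fun y => wedge (a y) (b y)) s x := by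
  have hL : ContDiff ℝ k (ContinuousAlternatingMap.alternatizeUncurryFinCLM (n := n) ℝ E F) := by
    fun_prop
  exact hL.comp_contDiffWithinAt (ha.smulRight hb)

theorem contDiffWithinAt_oneForm {G : Type*} [NormedAddCommGroup G] [NormedSpace ℝ G]
    {k : WithTop ℕ∞} {a : G → E →L[ℝ] ℝ} {s : Set G} {x : G}
    (ha : ContDiffWithinAt ℝ k a s x) : ContDiffWithinAt ℝ k (fun y => oneForm (a y)) s x :=
  (ContinuousAlternatingMap.ofSubsingletonLIE (𝕜 := ℝ) (E := E) (F := ℝ) (0 : Fin 1)).contDiff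
    |>.comp_contDiffWithinAt ha

end Exterior

/-! ### The `G₂` form as a polynomial expression. -/

theorem inner_V8 (x y : V8) : inner ℝ x y = x 0 * y 0 + x 1 * y 1 + x 2 * y 2 + x 3 * y 3 +
    x 4 * y 4 + x 5 * y 5 + x 6 * y 6 + x 7 * y 7 := by
  simp [PiLp.inner_apply, Fin.sum_univ_eight]
  ring

theorem inner_V3 (x y : V3) : inner ℝ x y = x 0 * y 0 + x 1 * y 1 + x 2 * y 2 := by
  simp [PiLp.inner_apply, Fin.sum_univ_three]
  ring

/-- `Y₁` as a linear map. -/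
def Y1L : V8 →L[ℝ] V8 := LinearMap.toContinuousLinearMap
  { toFun := Y1
    map_add' := fun x y => by ext i; fin_cases i <;> simp [Y1] <;> ring
    map_smul' := fun c x => by ext i; fin_cases i <;> simp [Y1] }

/-- `Y₂` as a linear map. -/
def Y2L : V8 →L[ℝ] V8 := LinearMap.toContinuousLinearMap
  { toFun := Y2
    map_add' := fun x y => by ext i; fin_cases i <;> simp [Y2] <;> ring
    map_smul' := fun c x => by ext i; fin_cases i <;> simp [Y2] }

/-- `Y₃` as a linear map. -/
def Y3L : V8 →L[ℝ] V8 := LinearMap.toContinuousLinearMap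
  { toFun := Y3
    map_add' := fun x y => by ext i; fin_cases i <;> simp [Y3] <;> ring
    map_smul' := fun c x => by ext i; fin_cases i <;> simp [Y3] }

@[simp] theorem Y1L_apply (x : V8) : Y1L x = Y1 x := rfl

@[simp] theorem Y2L_apply (x : V8) : Y2L x = Y2 x := rfl

@[simp] theorem Y3L_apply (x : V8) : Y3L x = Y3 x := rfl

theorem R_ne_zero {x : V8} (hx : x ≠ 0) : R x ≠ 0 := by simpa [R] using hx

theorem hasFDerivAt_R (x : V8) : HasFDerivAt R ((2 : ℝ) • innerSL ℝ x) x :=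
  by
  refine (hasStrictFDerivAt_norm_sq x).hasFDerivAt.congr_fderiv ?_
  ext y
  simp [two_smul]

theorem dR_apply (x p : V8) : dR x p = 2 * inner ℝ x p := by
  rw [dR, (hasFDerivAt_R x).fderiv]
  simp

theorem contDiff_R : ContDiff ℝ ∞ R := contDiff_norm_sq ℝ

theorem contDiffAt_hatForm (Y : V8 →L[ℝ] V8) {x : V8} (hx : x ≠ 0) :
    ContDiffAt ℝ ∞ (hatForm Y) x :=
  (contDiff_R.contDiffAt.inv (R_ne_zero hx)).smul
    ((innerSL ℝ).contDiff.comp Y.contDiff).contDiffAt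

theorem contDiffAt_omega {x : V8} (hx : x ≠ 0) : ContDiffAt ℝ ∞ omega x := by
  have h1 : ContDiffAt ℝ ∞ (fun y => oneForm (hatForm Y1 y)) x :=
    contDiffWithinAt_oneForm (contDiffAt_hatForm Y1L hx)
  refine ContDiffAt.add ?_ (ContDiffAt.const_smul _ (contDiffWithinAt_wedge
    (contDiffAt_hatForm Y2L hx) (contDiffWithinAt_oneForm (contDiffAt_hatForm Y3L hx))))
  exact (ContinuousAlternatingMap.alternatizeUncurryFinCLM ℝ V8 ℝ).contDiff.contDiffAt.comp x
    (h1.fderiv_right (m := ∞) (by simp))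

theorem hasFDerivAt_inner_left (Y : V8 →L[ℝ] V8) (x p : V8) :
    HasFDerivAt (fun y => inner ℝ (Y y) p) ((innerSL ℝ p).comp Y) x := by
  have h := ((innerSL ℝ p).comp Y).hasFDerivAt (x := x)
  refine h.congr_of_eventuallyEq (Filter.Eventually.of_forall fun y => ?_)
  simp [real_inner_comm]

/-- The factor R³/3 clears all the inverse powers of R in the forms α̂ᵢ, so that only polynomials
remain to be differentiated for φ. -/
theorem omega_apply {x : V8} (hx : x ≠ 0) (p q : V8) :
    R x ^ 3 / 3 * omega x ![p, q] =
      2 / 3 * R x ^ 2 * inner ℝ (Y1 p) q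
      - 2 / 3 * R x * (inner ℝ x p * inner ℝ (Y1 x) q - inner ℝ x q * inner ℝ (Y1 x) p)
      + R x * (inner ℝ (Y2 x) p * inner ℝ (Y3 x) q - inner ℝ (Y2 x) q * inner ℝ (Y3 x) p) := by
  have h1 : DifferentiableAt ℝ (fun y => oneForm (hatForm Y1 y)) x :=
    ContDiffAt.differentiableAt
      (contDiffWithinAt_oneForm (contDiffAt_hatForm Y1L hx) : ContDiffAt ℝ ∞ _ x) (by simp)
  have h2 (b c : V8) : fderiv ℝ (fun y => hatForm Y1 y c) x b =
      (R x)⁻¹ * inner ℝ (Y1 b) c - (R x ^ 2)⁻¹ * (2 * inner ℝ x b) * inner ℝ (Y1 x) c := by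
    have := ((hasDerivAt_inv (R_ne_zero hx)).comp_hasFDerivAt x (hasFDerivAt_R x)).mul
      (hasFDerivAt_inner_left Y1L x c)
    have e : (fun y => hatForm Y1 y c) = (Inv.inv ∘ R) * fun y => inner ℝ (Y1L y) c := by
      ext y; exact mul_comm _ _ |>.trans (mul_comm _ _)
    rw [e, this.fderiv]
    simp only [add_apply, smul_apply, innerSL_apply_apply,
      ContinuousLinearMap.comp_apply, smul_eq_mul, Function.comp, real_inner_comm c]
    simp only [Y1L_apply]
    ring
  -- `Y1` is skew, so the two halves of its exterior derivative add up.
  have h3 : inner ℝ (Y1 q) p = - inner ℝ (Y1 p) q := by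
    simp only [inner_V8]; simp [Y1]; ring
  have h4 : extDeriv (fun y => oneForm (hatForm Y1 y)) x ![p, q] =
      fderiv ℝ (fun y => hatForm Y1 y q) x p - fderiv ℝ (fun y => hatForm Y1 y p) x q := by
    rw [extDeriv_apply h1, Fin.sum_univ_two]
    simp [Fin.removeNth, sub_eq_add_neg]
  have hR := R_ne_zero hx
  simp only [omega, ContinuousAlternatingMap.add_apply, ContinuousAlternatingMap.smul_apply,
    wedge_oneForm_apply, h4, h2, h3]
  simp [hatForm]
  field_simp
  ring

/-- The derivative in the direction `a` of the component `(b, c)` of the `2`-form `R³ ω / 3`. -/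
def omegaDeriv (x a b c : V8) : ℝ :=
  8 / 3 * R x * inner ℝ x a * inner ℝ (Y1 b) c
  - 4 / 3 * inner ℝ x a * (inner ℝ x b * inner ℝ (Y1 x) c - inner ℝ x c * inner ℝ (Y1 x) b)
  - 2 / 3 * R x * (inner ℝ a b * inner ℝ (Y1 x) c - inner ℝ a c * inner ℝ (Y1 x) b +
      (inner ℝ x b * inner ℝ (Y1 a) c - inner ℝ x c * inner ℝ (Y1 a) b))
  + 2 * inner ℝ x a * (inner ℝ (Y2 x) b * inner ℝ (Y3 x) c - inner ℝ (Y2 x) c * inner ℝ (Y3 x) b)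
  + R x * (inner ℝ (Y2 a) b * inner ℝ (Y3 x) c - inner ℝ (Y2 a) c * inner ℝ (Y3 x) b +
      (inner ℝ (Y2 x) b * inner ℝ (Y3 a) c - inner ℝ (Y2 x) c * inner ℝ (Y3 a) b))

theorem fderiv_omega_apply {x : V8} (hx : x ≠ 0) (a b c : V8) :
    fderiv ℝ (fun y => ((R y ^ 3 / 3) • omega y) ![b, c]) x a = omegaDeriv x a b c := by
  -- The polynomial formula holds away from the origin, hence near x, which suffices for the
  -- derivative.
  have e : (fun y => ((R y ^ 3 / 3) • omega y) ![b, c]) =ᶠ[nhds x] fun y =>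
      2 / 3 * R y ^ 2 * inner ℝ (Y1 b) c
      - 2 / 3 * R y * (inner ℝ y b * inner ℝ (Y1 y) c - inner ℝ y c * inner ℝ (Y1 y) b)
      + R y * (inner ℝ (Y2 y) b * inner ℝ (Y3 y) c - inner ℝ (Y2 y) c * inner ℝ (Y3 y) b) := by
    filter_upwards [isOpen_ne.mem_nhds hx] with y hy
    rw [← omega_apply hy]
    simp
  have hR := hasFDerivAt_R x
  have hI (c : V8) := hasFDerivAt_inner_left (.id ℝ V8) x c
  have h1 (c : V8) := hasFDerivAt_inner_left Y1L x c
  have h2 (c : V8) := hasFDerivAt_inner_left Y2L x c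
  have h3 (c : V8) := hasFDerivAt_inner_left Y3L x c
  have key := ((((hR.pow 2).const_mul (2 / 3)).mul_const (inner ℝ (Y1 b) c)).sub
    ((hR.const_mul (2 / 3)).mul (((hI b).mul (h1 c)).sub ((hI c).mul (h1 b))))).add
    (hR.mul (((h2 b).mul (h3 c)).sub ((h2 c).mul (h3 b))))
  rw [e.fderiv_eq]
  refine (congrArg (fun f => f a) key.fderiv).trans ?_
  simp only [omegaDeriv, add_apply, sub_apply, smul_apply, innerSL_apply_apply, Pi.sub_apply,
    Pi.mul_apply, ContinuousLinearMap.comp_apply, smul_eq_mul, ContinuousLinearMap.id_apply,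
    real_inner_comm b, real_inner_comm c, Y1L_apply, Y2L_apply, Y3L_apply, nsmul_eq_mul]
  push_cast
  ring

theorem phi_apply {x : V8} (hx : x ≠ 0) (a b c : V8) :
    phi x ![a, b, c] = omegaDeriv x a b c - omegaDeriv x b a c + omegaDeriv x c a b := by
  have h : ContDiffAt ℝ ∞ (fun y => (R y ^ 3 / 3) • omega y) x :=
    ((contDiff_R.pow 3).div_const 3).contDiffAt.smul (contDiffAt_omega hx)
  rw [phi, extDeriv_apply (h.differentiableAt (by simp)), Fin.sum_univ_three]
  have h0 : (0 : Fin 3).removeNth ![a, b, c] = ![b, c] := by ext i; fin_cases i <;> rfl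
  have h1 : (1 : Fin 3).removeNth ![a, b, c] = ![a, c] := by ext i; fin_cases i <;> rfl
  have h2 : (2 : Fin 3).removeNth ![a, b, c] = ![a, b] := by ext i; fin_cases i <;> rfl
  rw [h0, h1, h2, fderiv_omega_apply hx, fderiv_omega_apply hx, fderiv_omega_apply hx]
  simp
  ring

/-! ### The quadratic map `Q` -/

/-- The differential of `Q`. -/
def dQ (x p : V8) : Bivector :=
  (!₂[2 * (x 0 * p 0 + x 1 * p 1 - x 4 * p 4 - x 5 * p 5),
      2 * (x 0 * p 4 + p 0 * x 4 + x 1 * p 5 + p 1 * x 5),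
      2 * (x 0 * p 5 + p 0 * x 5 - x 1 * p 4 - p 1 * x 4)],
   !₂[2 * (x 2 * p 2 + x 3 * p 3 - x 6 * p 6 - x 7 * p 7),
      2 * (x 2 * p 6 + p 2 * x 6 + x 3 * p 7 + p 3 * x 7),
      2 * (x 2 * p 7 + p 2 * x 7 - x 3 * p 6 - p 3 * x 6)])

theorem differentiable_Q : Differentiable ℝ Q := by
  refine Differentiable.prodMk (differentiable_euclidean.2 fun i => ?_)
    (differentiable_euclidean.2 fun i => ?_) <;> fin_cases i <;> simp <;> fun_prop

/-- `Q` is quadratic, so its expansion along a line stops at second order and the derivative can be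
read off. -/
theorem Q_add_smul (x p : V8) (t : ℝ) : Q (x + t • p) = Q x + t • dQ x p + t ^ 2 • Q p := by
  refine Prod.ext (PiLp.ext fun i => ?_) (PiLp.ext fun i => ?_) <;> fin_cases i <;>
    simp [Q, dQ] <;> ring

theorem fderiv_Q_apply (x p : V8) : fderiv ℝ Q x p = dQ x p := by
  rw [← (differentiable_Q x).lineDeriv_eq_fderiv]
  have h : HasDerivAt (fun t : ℝ => Q x + t • dQ x p + t ^ 2 • Q p) (dQ x p) 0 := by
    have := (((hasDerivAt_id (0 : ℝ)).smul_const (dQ x p)).const_add (Q x)).fun_add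
      (((hasDerivAt_id (0 : ℝ)).pow 2).smul_const (Q p))
    simpa using this
  have h2 : HasLineDerivAt ℝ Q (dQ x p) x p := by
    rw [HasLineDerivAt]
    simpa only [Q_add_smul] using h
  exact h2.lineDeriv

/-- The Hopf map sends a spinor of length r to a vector of length r²; no square roots survive on ℝ⁸.
-/
theorem norm_Q_fst (x : V8) : ‖(Q x).1‖ = x 0 ^ 2 + x 1 ^ 2 + x 4 ^ 2 + x 5 ^ 2 := by
  rw [← sq_eq_sq₀ (norm_nonneg _) (by positivity), ← real_inner_self_eq_norm_sq, inner_V3]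
  simp [Q]
  ring

theorem norm_Q_snd (x : V8) : ‖(Q x).2‖ = x 2 ^ 2 + x 3 ^ 2 + x 6 ^ 2 + x 7 ^ 2 := by
  rw [← sq_eq_sq₀ (norm_nonneg _) (by positivity), ← real_inner_self_eq_norm_sq, inner_V3]
  simp [Q]
  ring

theorem norm_Q_pos {x : V8} (hx : Q x ∈ smoothLocus) :
    0 < x 0 ^ 2 + x 1 ^ 2 + x 4 ^ 2 + x 5 ^ 2 ∧ 0 < x 2 ^ 2 + x 3 ^ 2 + x 6 ^ 2 + x 7 ^ 2 := by
  rw [← norm_Q_fst, ← norm_Q_snd]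
  exact ⟨norm_pos_iff.2 hx.1, norm_pos_iff.2 hx.2⟩

theorem ne_zero_of_Q_mem {x : V8} (hx : Q x ∈ smoothLocus) : x ≠ 0 := by
  rintro rfl
  simpa using (norm_Q_pos hx).1

theorem R_eq (x : V8) : R x = (x 0 ^ 2 + x 1 ^ 2 + x 4 ^ 2 + x 5 ^ 2) +
    (x 2 ^ 2 + x 3 ^ 2 + x 6 ^ 2 + x 7 ^ 2) := by
  rw [R, ← real_inner_self_eq_norm_sq, inner_V8]
  ring

/-- By Cauchy–Schwarz, N₂ ≥ 4uv. -/
theorem N2_pos {a b : V3} (ha : a ≠ 0) (hb : b ≠ 0) : 0 < N2 a b := by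
  have h := real_inner_le_norm a b
  have h2 : 0 < ‖a‖ * ‖b‖ := mul_pos (norm_pos_iff.2 ha) (norm_pos_iff.2 hb)
  rw [N2]
  linarith

/-! ### The induced tensors -/

/-- The vector-valued `1`-form `d𝐯 / 2v - d𝐮 / 2u`. -/
def shape (m : Bivector) : Bivector →L[ℝ] V3 :=
  (2 * ‖m.2‖)⁻¹ • ContinuousLinearMap.snd ℝ V3 V3 - (2 * ‖m.1‖)⁻¹ • ContinuousLinearMap.fst ℝ V3 V3

theorem shape_apply (m W : Bivector) :
    shape m W = (2 * ‖m.2‖)⁻¹ • W.2 - (2 * ‖m.1‖)⁻¹ • W.1 := rfl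

/-- The `1`-form `du`, with `u = |𝐮|`. -/
def dNormFst (m : Bivector) : Bivector →L[ℝ] ℝ :=
  ‖m.1‖⁻¹ • (innerSL ℝ m.1).comp (ContinuousLinearMap.fst ℝ V3 V3)

/-- The `1`-form `dv`, with `v = |𝐯|`. -/
def dNormSnd (m : Bivector) : Bivector →L[ℝ] ℝ :=
  ‖m.2‖⁻¹ • (innerSL ℝ m.2).comp (ContinuousLinearMap.snd ℝ V3 V3)

theorem dNormFst_apply (m W : Bivector) : dNormFst m W = ‖m.1‖⁻¹ * inner ℝ m.1 W.1 := rfl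

theorem dNormSnd_apply (m W : Bivector) : dNormSnd m W = ‖m.2‖⁻¹ * inner ℝ m.2 W.2 := rfl

/-- The bilinear form `(W, Z) ↦ ⟪S W, T Z⟫`. -/
def innerComp (S T : Bivector →L[ℝ] V3) : Bivector →L[ℝ] Bivector →L[ℝ] ℝ :=
  ∑ i, ((EuclideanSpace.proj i : V3 →L[ℝ] ℝ).comp S).smulRight
    ((EuclideanSpace.proj i : V3 →L[ℝ] ℝ).comp T)

theorem innerComp_apply (S T : Bivector →L[ℝ] V3) (W Z : Bivector) :
    innerComp S T W Z = inner ℝ (S W) (T Z) := by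
  simp [innerComp, inner_V3, Fin.sum_univ_three]

/-- The induced metric `g₂`. -/
def metric (m : Bivector) : Bivector →L[ℝ] Bivector →L[ℝ] ℝ :=
  let dr := dNormFst m + dNormSnd m
  let aD := (innerSL ℝ m.1).comp (shape m)
  let bD := (innerSL ℝ m.2).comp (shape m)
  (1 / 2 : ℝ) • dr.smulRight dr
  + ((‖m.1‖ + ‖m.2‖) / (2 * ‖m.1‖)) • innerComp (ContinuousLinearMap.fst ℝ V3 V3)
      (ContinuousLinearMap.fst ℝ V3 V3)
  + ((‖m.1‖ + ‖m.2‖) / (2 * ‖m.2‖)) • innerComp (ContinuousLinearMap.snd ℝ V3 V3)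
      (ContinuousLinearMap.snd ℝ V3 V3)
  - (N2 m.1 m.2)⁻¹ • ((4 * ‖m.1‖ * ‖m.2‖ * (‖m.1‖ * ‖m.2‖ - inner ℝ m.1 m.2)) •
        innerComp (shape m) (shape m)
      + (3 * ‖m.1‖ * ‖m.2‖) • (aD.smulRight bD + bD.smulRight aD)
      - ‖m.1‖ ^ 2 • bD.smulRight bD - ‖m.2‖ ^ 2 • aD.smulRight aD)

set_option synthInstance.maxHeartbeats 200000 in
theorem metric_apply (m W Z : Bivector) : metric m W Z =
    1 / 2 * (dNormFst m W + dNormSnd m W) * (dNormFst m Z + dNormSnd m Z)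
    + (‖m.1‖ + ‖m.2‖) / (2 * ‖m.1‖) * inner ℝ W.1 Z.1
    + (‖m.1‖ + ‖m.2‖) / (2 * ‖m.2‖) * inner ℝ W.2 Z.2
    - (N2 m.1 m.2)⁻¹ * (4 * ‖m.1‖ * ‖m.2‖ * (‖m.1‖ * ‖m.2‖ - inner ℝ m.1 m.2) *
        inner ℝ (shape m W) (shape m Z)
      + 3 * ‖m.1‖ * ‖m.2‖ * (inner ℝ m.1 (shape m W) * inner ℝ m.2 (shape m Z) +
          inner ℝ m.2 (shape m W) * inner ℝ m.1 (shape m Z))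
      - ‖m.1‖ ^ 2 * (inner ℝ m.2 (shape m W) * inner ℝ m.2 (shape m Z))
      - ‖m.2‖ ^ 2 * (inner ℝ m.1 (shape m W) * inner ℝ m.1 (shape m Z))) := by
  simp [metric, innerComp_apply, -one_div]
  ring

/-- The `1`-form `𝐮 · d𝐯 - 𝐯 · d𝐮`. -/
def angular (m : Bivector) : Bivector →L[ℝ] ℝ :=
  (innerSL ℝ m.1).comp (ContinuousLinearMap.snd ℝ V3 V3)
    - (innerSL ℝ m.2).comp (ContinuousLinearMap.fst ℝ V3 V3)

theorem angular_apply (m W : Bivector) :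
    angular m W = inner ℝ m.1 W.2 - inner ℝ m.2 W.1 := rfl

/-- The induced `2`-form `σ`. -/
def sigma (m : Bivector) : Bivector [⋀^Fin 2]→L[ℝ] ℝ :=
  (‖m.1‖ + ‖m.2‖) • ∑ i, wedge (du i) (oneForm (dv i))
  - ((‖m.1‖ + ‖m.2‖) / 2) • wedge (dNormFst m) (oneForm (dNormSnd m))
  + (1 / 2 : ℝ) • wedge (dNormFst m + dNormSnd m) (oneForm (angular m))

theorem sigma_apply (m W Z : Bivector) : sigma m ![W, Z] =
    (‖m.1‖ + ‖m.2‖) * (inner ℝ W.1 Z.2 - inner ℝ W.2 Z.1)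
    - (‖m.1‖ + ‖m.2‖) / 2 * (dNormFst m W * dNormSnd m Z - dNormFst m Z * dNormSnd m W)
    + 1 / 2 * ((dNormFst m W + dNormSnd m W) * angular m Z -
        (dNormFst m Z + dNormSnd m Z) * angular m W) := by
  simp only [sigma, ContinuousAlternatingMap.add_apply, ContinuousAlternatingMap.sub_apply,
    ContinuousAlternatingMap.smul_apply, wedge_oneForm_apply, Fin.sum_univ_three, smul_eq_mul,
    inner_V3, du, dv, ContinuousLinearMap.comp_apply, ContinuousLinearMap.coe_fst',
    ContinuousLinearMap.coe_snd', PiLp.proj_apply, Matrix.cons_val_zero,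
    Matrix.cons_val_one, add_apply]
  ring

theorem dNormFst_dQ {x : V8} (hx : Q x ∈ smoothLocus) (p : V8) : dNormFst (Q x) (dQ x p) =
    2 * (x 0 * p 0 + x 1 * p 1 + x 4 * p 4 + x 5 * p 5) := by
  have h := (norm_Q_pos hx).1
  rw [dNormFst_apply, norm_Q_fst, inner_V3]
  simp [Q, dQ]
  field_simp
  ring

theorem dNormSnd_dQ {x : V8} (hx : Q x ∈ smoothLocus) (p : V8) : dNormSnd (Q x) (dQ x p) =
    2 * (x 2 * p 2 + x 3 * p 3 + x 6 * p 6 + x 7 * p 7) := by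
  have h := (norm_Q_pos hx).2
  rw [dNormSnd_apply, norm_Q_snd, inner_V3]
  simp [Q, dQ]
  field_simp
  ring

-- After substituting the polynomial forms of the norms, of their differentials and of φ, both sides
-- are the same polynomial in the coordinates of x, p, q.
set_option maxHeartbeats 1000000 in
theorem sigma_dQ {x : V8} (hx : Q x ∈ smoothLocus) (p q : V8) :
    sigma (Q x) ![dQ x p, dQ x q] = phi x ![X x, p, q] := by
  rw [sigma_apply, phi_apply (ne_zero_of_Q_mem hx), dNormFst_dQ hx, dNormFst_dQ hx, dNormSnd_dQ hx,
    dNormSnd_dQ hx, angular_apply, angular_apply, norm_Q_fst, norm_Q_snd]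
  simp only [omegaDeriv, inner_V8, inner_V3, R_eq]
  simp [Q, dQ, X, Y1, Y2, Y3]
  ring

/-! ### The cone metric in terms of spinors. -/

theorem X_inner (x p : V8) : inner ℝ (X x) p = (x 0 * p 1 - x 1 * p 0 + x 4 * p 5 - x 5 * p 4) +
    (x 2 * p 3 - x 3 * p 2 + x 6 * p 7 - x 7 * p 6) := by
  rw [inner_V8]
  simp [X]
  ring

/-- The weights −2, −1, −1 arise because `sphereMetric` removes each α̂ᵢ² twice while α̂₂² and α̂₃²
are restored once; the radial weight is 4 − 2. -/
theorem coneMetric_apply {x : V8} (hx : x ≠ 0) (p q : V8) : coneMetric x p q =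
    2 * inner ℝ x p * inner ℝ x q + 2 * R x * inner ℝ p q
    - 2 * (inner ℝ (Y1 x) p * inner ℝ (Y1 x) q) - inner ℝ (Y2 x) p * inner ℝ (Y2 x) q
    - inner ℝ (Y3 x) p * inner ℝ (Y3 x) q := by
  have := R_ne_zero hx
  simp only [coneMetric, nearlyKahlerMetric, sphereMetric, dR_apply, hatForm, smul_apply,
    innerSL_apply_apply, smul_eq_mul]
  field_simp
  ring

/-- The angular `1`-form of the spinor `z = (x₀ + i x₁, x₄ + i x₅)`. -/
def thetaFst (x p : V8) : ℝ := x 0 * p 1 - x 1 * p 0 + x 4 * p 5 - x 5 * p 4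

/-- The angular `1`-form of the spinor `w = (x₂ + i x₃, x₆ + i x₇)`. -/
def thetaSnd (x p : V8) : ℝ := x 2 * p 3 - x 3 * p 2 + x 6 * p 7 - x 7 * p 6

/-- The real part of the hermitian product of the spinors `z` and `w`. -/
def zetaRe (x : V8) : ℝ := x 0 * x 2 + x 1 * x 3 + x 4 * x 6 + x 5 * x 7

/-- The imaginary part of the hermitian product of the spinors `z` and `w`. -/
def zetaIm (x : V8) : ℝ := x 0 * x 3 - x 1 * x 2 + x 4 * x 7 - x 5 * x 6

/-- The real part of the matrix element between `z` and `w` of the Pauli matrix of `d`. -/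
def pauliRe (x : V8) (d : V3) : ℝ := d 0 * (x 0 * x 2 + x 1 * x 3 - x 4 * x 6 - x 5 * x 7) +
  d 1 * (x 0 * x 6 + x 1 * x 7 + x 4 * x 2 + x 5 * x 3) +
  d 2 * (x 0 * x 7 - x 1 * x 6 - x 4 * x 3 + x 5 * x 2)

/-- The imaginary part of the matrix element between `z` and `w` of the Pauli matrix of `d`. -/
def pauliIm (x : V8) (d : V3) : ℝ := d 0 * (x 0 * x 3 - x 1 * x 2 - x 4 * x 7 + x 5 * x 6) +
  d 1 * (x 0 * x 7 - x 1 * x 6 + x 4 * x 3 - x 5 * x 2) +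
  d 2 * (x 4 * x 2 + x 5 * x 3 - x 0 * x 6 - x 1 * x 7)

/-- The triple product of three vectors. -/
def det3 (a b c : V3) : ℝ := a 0 * (b 1 * c 2 - b 2 * c 1) - a 1 * (b 0 * c 2 - b 2 * c 0) +
  a 2 * (b 0 * c 1 - b 1 * c 0)

/-- A product of two determinants is the Gram determinant of scalar products, expanded here. -/
theorem det3_mul_det3 (a b c d : V3) : det3 a b c * det3 a b d =
    (‖a‖ ^ 2 * ‖b‖ ^ 2 - inner ℝ a b ^ 2) * inner ℝ c d
    - ‖a‖ ^ 2 * (inner ℝ b c * inner ℝ b d) - ‖b‖ ^ 2 * (inner ℝ a c * inner ℝ a d)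
    + inner ℝ a b * (inner ℝ a c * inner ℝ b d + inner ℝ b c * inner ℝ a d) := by
  simp only [← real_inner_self_eq_norm_sq, inner_V3, det3]
  ring

/-- Fierz identity: zz* = (u + 𝐮·σ)/2 and ww* = (v + 𝐯·σ)/2, so the real part of (z*σ_c w)(w*σ_d z)
is the real part of a trace of Pauli matrices. In `zeta_pauli` and `zeta_sq` one or both of σ_c, σ_d
are replaced by the identity. -/
theorem pauli_mul_pauli (x : V8) (c d : V3) :
    pauliRe x c * pauliRe x d + pauliIm x c * pauliIm x d =
      1 / 2 * ((‖(Q x).1‖ * ‖(Q x).2‖ - inner ℝ (Q x).1 (Q x).2) * inner ℝ c d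
        + inner ℝ (Q x).1 c * inner ℝ (Q x).2 d + inner ℝ (Q x).2 c * inner ℝ (Q x).1 d) := by
  rw [norm_Q_fst, norm_Q_snd]
  simp only [inner_V3, pauliRe, pauliIm]
  simp [Q]
  ring

theorem zeta_pauli (x : V8) (d : V3) :
    zetaIm x * pauliRe x d - zetaRe x * pauliIm x d = 1 / 2 * det3 (Q x).1 (Q x).2 d := by
  simp only [det3, pauliRe, pauliIm, zetaRe, zetaIm]
  simp [Q]
  ring

theorem zeta_sq (x : V8) : zetaRe x ^ 2 + zetaIm x ^ 2 =
    1 / 2 * (‖(Q x).1‖ * ‖(Q x).2‖ + inner ℝ (Q x).1 (Q x).2) := by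
  rw [norm_Q_fst, norm_Q_snd]
  simp only [inner_V3, zetaRe, zetaIm]
  simp [Q]
  ring

theorem inner_Y1 (x p : V8) : inner ℝ (Y1 x) p = thetaFst x p - thetaSnd x p := by
  rw [inner_V8, thetaFst, thetaSnd]
  simp [Y1]
  ring

theorem shape_dQ {x : V8} (hx : Q x ∈ smoothLocus) (p : V8) (i : Fin 3) :
    2 * ‖(Q x).1‖ * ‖(Q x).2‖ * shape (Q x) (dQ x p) i =
      ‖(Q x).1‖ * (dQ x p).2 i - ‖(Q x).2‖ * (dQ x p).1 i := by
  have h1 := norm_pos_iff.2 hx.1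
  have h2 := norm_pos_iff.2 hx.2
  simp [shape_apply]
  field_simp

/-- Together with `inner_Y3` this says ⟨Y₂, ·⟩ + i⟨Y₃, ·⟩ = z*σ_D w + iζS, where ζ = z*w, D is the
`shape` form and S = θ_z/u + θ_w/v. -/
theorem inner_Y2 {x : V8} (hx : Q x ∈ smoothLocus) (p : V8) : inner ℝ (Y2 x) p =
    pauliRe x (shape (Q x) (dQ x p)) - zetaIm x *
      ((‖(Q x).2‖ * thetaFst x p + ‖(Q x).1‖ * thetaSnd x p) / (‖(Q x).1‖ * ‖(Q x).2‖)) := by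
  have h1 := norm_pos_iff.2 hx.1
  have h2 := norm_pos_iff.2 hx.2
  have e : 2 * ‖(Q x).1‖ * ‖(Q x).2‖ * pauliRe x (shape (Q x) (dQ x p)) =
      ‖(Q x).1‖ * pauliRe x (dQ x p).2 - ‖(Q x).2‖ * pauliRe x (dQ x p).1 := by
    simp only [pauliRe]
    linear_combination (x 0 * x 2 + x 1 * x 3 - x 4 * x 6 - x 5 * x 7) * shape_dQ hx p 0 +
      (x 0 * x 6 + x 1 * x 7 + x 4 * x 2 + x 5 * x 3) * shape_dQ hx p 1 +
      (x 0 * x 7 - x 1 * x 6 - x 4 * x 3 + x 5 * x 2) * shape_dQ hx p 2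
  have e2 : 2 * (‖(Q x).1‖ * ‖(Q x).2‖) * inner ℝ (Y2 x) p =
      ‖(Q x).1‖ * pauliRe x (dQ x p).2 - ‖(Q x).2‖ * pauliRe x (dQ x p).1 -
      2 * zetaIm x * (‖(Q x).2‖ * thetaFst x p + ‖(Q x).1‖ * thetaSnd x p) := by
    rw [norm_Q_fst, norm_Q_snd, inner_V8]
    simp only [pauliRe, zetaIm, thetaFst, thetaSnd]
    simp [dQ, Y2]
    ring
  field_simp
  linear_combination 1 / 2 * e2 - 1 / 2 * e

theorem inner_Y3 {x : V8} (hx : Q x ∈ smoothLocus) (p : V8) : inner ℝ (Y3 x) p =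
    pauliIm x (shape (Q x) (dQ x p)) + zetaRe x *
      ((‖(Q x).2‖ * thetaFst x p + ‖(Q x).1‖ * thetaSnd x p) / (‖(Q x).1‖ * ‖(Q x).2‖)) := by
  have h1 := norm_pos_iff.2 hx.1
  have h2 := norm_pos_iff.2 hx.2
  have e : 2 * ‖(Q x).1‖ * ‖(Q x).2‖ * pauliIm x (shape (Q x) (dQ x p)) =
      ‖(Q x).1‖ * pauliIm x (dQ x p).2 - ‖(Q x).2‖ * pauliIm x (dQ x p).1 := by
    simp only [pauliIm]
    linear_combination (x 0 * x 3 - x 1 * x 2 - x 4 * x 7 + x 5 * x 6) * shape_dQ hx p 0 +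
      (x 0 * x 7 - x 1 * x 6 + x 4 * x 3 - x 5 * x 2) * shape_dQ hx p 1 +
      (x 4 * x 2 + x 5 * x 3 - x 0 * x 6 - x 1 * x 7) * shape_dQ hx p 2
  have e2 : 2 * (‖(Q x).1‖ * ‖(Q x).2‖) * inner ℝ (Y3 x) p =
      ‖(Q x).1‖ * pauliIm x (dQ x p).2 - ‖(Q x).2‖ * pauliIm x (dQ x p).1 +
      2 * zetaRe x * (‖(Q x).2‖ * thetaFst x p + ‖(Q x).1‖ * thetaSnd x p) := by
    rw [norm_Q_fst, norm_Q_snd, inner_V8]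
    simp only [pauliIm, zetaRe, thetaFst, thetaSnd]
    simp [dQ, Y3]
    ring
  field_simp
  linear_combination 1 / 2 * e2 - 1 / 2 * e

/-- This is the polarised Hopf fibration formula |dz|² = |d𝐮|²/4u + θ_z²/u, for both spinors. -/
theorem inner_V8_eq {x : V8} (hx : Q x ∈ smoothLocus) (p q : V8) : inner ℝ p q =
    (inner ℝ (dQ x p).1 (dQ x q).1 + 4 * thetaFst x p * thetaFst x q) / (4 * ‖(Q x).1‖) +
    (inner ℝ (dQ x p).2 (dQ x q).2 + 4 * thetaSnd x p * thetaSnd x q) / (4 * ‖(Q x).2‖) := by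
  have h1 : inner ℝ (dQ x p).1 (dQ x q).1 + 4 * thetaFst x p * thetaFst x q =
      4 * ‖(Q x).1‖ * (p 0 * q 0 + p 1 * q 1 + p 4 * q 4 + p 5 * q 5) := by
    rw [norm_Q_fst, inner_V3, thetaFst, thetaFst]
    simp [dQ]
    ring
  have h2 : inner ℝ (dQ x p).2 (dQ x q).2 + 4 * thetaSnd x p * thetaSnd x q =
      4 * ‖(Q x).2‖ * (p 2 * q 2 + p 3 * q 3 + p 6 * q 6 + p 7 * q 7) := by
    rw [norm_Q_snd, inner_V3, thetaSnd, thetaSnd]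
    simp [dQ]
    ring
  have h3 := norm_pos_iff.2 hx.1
  have h4 := norm_pos_iff.2 hx.2
  rw [h1, h2, inner_V8]
  field_simp
  ring

theorem inner_position {x : V8} (hx : Q x ∈ smoothLocus) (p : V8) :
    2 * inner ℝ x p = dNormFst (Q x) (dQ x p) + dNormSnd (Q x) (dQ x p) := by
  rw [dNormFst_dQ hx, dNormSnd_dQ hx, inner_V8]
  ring

/-- X is orthogonal to x and pairs with Y₁, and with Y₂ + iY₃, to give u − v and 2iζ. The Fierz
identities then turn the ζ-terms into functions of 𝐮, 𝐯 and D. -/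
theorem coneMetric_X {x : V8} (hx : Q x ∈ smoothLocus) (p : V8) : coneMetric x (X x) p =
    N2 (Q x).1 (Q x).2 / 2 *
      ((‖(Q x).2‖ * thetaFst x p + ‖(Q x).1‖ * thetaSnd x p) / (‖(Q x).1‖ * ‖(Q x).2‖)) +
    det3 (Q x).1 (Q x).2 (shape (Q x) (dQ x p)) := by
  have h1 := norm_pos_iff.2 hx.1
  have h2 := norm_pos_iff.2 hx.2
  have e0 : inner ℝ x (X x) = 0 := by rw [inner_V8]; simp [X]; ring
  have e1 : inner ℝ (Y1 x) (X x) = ‖(Q x).1‖ - ‖(Q x).2‖ := by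
    rw [inner_V8, norm_Q_fst, norm_Q_snd]; simp [X, Y1]; ring
  have e2 : inner ℝ (Y2 x) (X x) = -2 * zetaIm x := by
    rw [inner_V8, zetaIm]; simp [X, Y2]; ring
  have e3 : inner ℝ (Y3 x) (X x) = 2 * zetaRe x := by
    rw [inner_V8, zetaRe]; simp [X, Y3]; ring
  have e4 : inner ℝ (X x) p = thetaFst x p + thetaSnd x p := X_inner x p
  have e5 : R x = ‖(Q x).1‖ + ‖(Q x).2‖ := by rw [R_eq, norm_Q_fst, norm_Q_snd]
  rw [coneMetric_apply (ne_zero_of_Q_mem hx), e0, e1, e2, e3, e4, e5, inner_Y1, inner_Y2 hx,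
    inner_Y3 hx, N2]
  have f1 := zeta_pauli x (shape (Q x) (dQ x p))
  have f2 := zeta_sq x
  generalize ‖(Q x).1‖ = u at *
  generalize ‖(Q x).2‖ = v at *
  field_simp
  linear_combination 4 * u * v * f1 - 4 * (v * thetaFst x p + u * thetaSnd x p) * f2

theorem coneMetric_X_X {x : V8} (hx : Q x ∈ smoothLocus) :
    coneMetric x (X x) (X x) = N2 (Q x).1 (Q x).2 := by
  have h1 := norm_pos_iff.2 hx.1
  have h2 := norm_pos_iff.2 hx.2
  have e1 : thetaFst x (X x) = ‖(Q x).1‖ := by rw [norm_Q_fst, thetaFst]; simp [X]; ring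
  have e2 : thetaSnd x (X x) = ‖(Q x).2‖ := by rw [norm_Q_snd, thetaSnd]; simp [X]; ring
  have e3 : dQ x (X x) = 0 := by
    refine Prod.ext (PiLp.ext fun i => ?_) (PiLp.ext fun i => ?_) <;> fin_cases i <;>
      simp [dQ, X] <;> ring
  rw [coneMetric_X hx, e1, e2, e3, map_zero]
  simp [det3]
  field_simp
  ring

/-- Completing the square in S: its coefficient is 2uv − |ζ|² = N₂/4, which matches h₂(X, ·)²/N₂
together with the cross terms. What remains is the square of det(𝐮, 𝐯, D) over N₂, which the Gram
identity rewrites in scalar products. -/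
theorem coneMetric_eq {x : V8} (hx : Q x ∈ smoothLocus) (p q : V8) : coneMetric x p q =
    metric (Q x) (dQ x p) (dQ x q) +
      (N2 (Q x).1 (Q x).2)⁻¹ * (coneMetric x (X x) p * coneMetric x (X x) q) := by
  have h1 := norm_pos_iff.2 hx.1
  have h2 := norm_pos_iff.2 hx.2
  have hN := N2_pos hx.1 hx.2
  have e5 : R x = ‖(Q x).1‖ + ‖(Q x).2‖ := by rw [R_eq, norm_Q_fst, norm_Q_snd]
  have f1 := zeta_pauli x (shape (Q x) (dQ x p))
  have f2 := zeta_pauli x (shape (Q x) (dQ x q))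
  have f3 := zeta_sq x
  have f4 := pauli_mul_pauli x (shape (Q x) (dQ x p)) (shape (Q x) (dQ x q))
  have f5 := det3_mul_det3 (Q x).1 (Q x).2 (shape (Q x) (dQ x p)) (shape (Q x) (dQ x q))
  rw [coneMetric_X hx, coneMetric_X hx, coneMetric_apply (ne_zero_of_Q_mem hx), e5,
    inner_Y1, inner_Y1, inner_Y2 hx, inner_Y2 hx, inner_Y3 hx, inner_Y3 hx, inner_position hx p,
    inner_V8_eq hx p q, metric_apply]
  have f6 := inner_position hx q
  have hN2 : N2 (Q x).1 (Q x).2 = 6 * ‖(Q x).1‖ * ‖(Q x).2‖ - 2 * inner ℝ (Q x).1 (Q x).2 := rfl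
  have hNi := inv_mul_cancel₀ hN.ne'
  generalize N2 (Q x).1 (Q x).2 = N at *
  generalize ‖(Q x).1‖ = u at *
  generalize ‖(Q x).2‖ = v at *
  -- The contributions of θ_z, θ_w from the Euclidean metric and from Y₁ combine into 2uv S².
  have f7 : 2 * (u + v) * (4 * thetaFst x p * thetaFst x q / (4 * u) +
        4 * thetaSnd x p * thetaSnd x q / (4 * v)) -
      2 * ((thetaFst x p - thetaSnd x p) * (thetaFst x q - thetaSnd x q)) =
      2 * (u * v) * (((v * thetaFst x p + u * thetaSnd x p) / (u * v)) *
        ((v * thetaFst x q + u * thetaSnd x q) / (u * v))) := by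
    field_simp
    ring
  generalize (v * thetaFst x p + u * thetaSnd x p) / (u * v) = S at *
  generalize (v * thetaFst x q + u * thetaSnd x q) / (u * v) = T at *
  -- By the Fierz identity, G is twice the Pauli product of the two shape vectors.
  set G := (u * v - inner ℝ (Q x).1 (Q x).2) *
      inner ℝ (shape (Q x) (dQ x p)) (shape (Q x) (dQ x q)) +
    inner ℝ (Q x).1 (shape (Q x) (dQ x p)) * inner ℝ (Q x).2 (shape (Q x) (dQ x q)) +
    inner ℝ (Q x).2 (shape (Q x) (dQ x p)) * inner ℝ (Q x).1 (shape (Q x) (dQ x q)) with hG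
  linear_combination (dNormFst (Q x) (dQ x p) + dNormSnd (Q x) (dQ x p)) / 2 * f6 + f7 - f4 +
    T * f1 + S * f2 - S * T * f3 - N⁻¹ * f5 - S * T / 4 * hN2 -
    1 / 2 * N⁻¹ * G * hN2 + (-S * T * N / 4 - S * det3 (Q x).1 (Q x).2 (shape (Q x) (dQ x q)) / 2 -
      T * det3 (Q x).1 (Q x).2 (shape (Q x) (dQ x p)) / 2 + G / 2) * hNi

/-! ### The almost complex structure -/

/-- The `V3`-component of `√N₂ J` on the side of `a`; the linear maps `S`, `T` extract the
components of a tangent vector on the sides of `a` and `b`. -/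
def rotPart (a b : V3) (S T : Bivector →L[ℝ] V3) : Bivector →L[ℝ] V3 :=
  (‖a‖ + ‖b‖)⁻¹ • (-(‖a‖ * ‖b‖ - inner ℝ a b) • S - (N2 a b / 2 + 2 * ‖a‖ ^ 2) • T
    + ((‖b‖ / (2 * ‖a‖)) • (innerSL ℝ a).comp S - (3 / 2 : ℝ) • (innerSL ℝ b).comp S
      + (1 / 2 : ℝ) • (innerSL ℝ a).comp T + (‖a‖ / (2 * ‖b‖)) • (innerSL ℝ b).comp T).smulRight a
    - ((2 : ℝ) • (innerSL ℝ a).comp S + (innerSL ℝ a).comp T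
      + (‖a‖ / ‖b‖) • (innerSL ℝ b).comp T).smulRight b)

theorem rotPart_apply (a b : V3) (S T : Bivector →L[ℝ] V3) (W : Bivector) : rotPart a b S T W =
    (‖a‖ + ‖b‖)⁻¹ • (-(‖a‖ * ‖b‖ - inner ℝ a b) • S W - (N2 a b / 2 + 2 * ‖a‖ ^ 2) • T W
    + (‖b‖ / (2 * ‖a‖) * inner ℝ a (S W) - 3 / 2 * inner ℝ b (S W)
      + 1 / 2 * inner ℝ a (T W) + ‖a‖ / (2 * ‖b‖) * inner ℝ b (T W)) • a
    - (2 * inner ℝ a (S W) + inner ℝ a (T W) + ‖a‖ / ‖b‖ * inner ℝ b (T W)) • b) := rfl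

/-- The endomorphism `√N₂ J`. -/
def rot (m : Bivector) : Bivector →L[ℝ] Bivector :=
  (rotPart m.1 m.2 (ContinuousLinearMap.fst ℝ V3 V3) (ContinuousLinearMap.snd ℝ V3 V3)).prod
    (-rotPart m.2 m.1 (ContinuousLinearMap.snd ℝ V3 V3) (ContinuousLinearMap.fst ℝ V3 V3))

theorem rot_apply (m W : Bivector) : rot m W =
    (rotPart m.1 m.2 (ContinuousLinearMap.fst ℝ V3 V3) (ContinuousLinearMap.snd ℝ V3 V3) W,
     -rotPart m.2 m.1 (ContinuousLinearMap.snd ℝ V3 V3) (ContinuousLinearMap.fst ℝ V3 V3) W) := rfl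

theorem N2_comm (a b : V3) : N2 a b = N2 b a := by
  rw [N2, N2, real_inner_comm]
  ring

/-- Every vector involved lies in the span of a, b, w, z with coefficients in scalar products, so
the identity is checked without choosing coordinates adapted to a and b. -/
theorem rot_rot_fst {a b : V3} (ha : a ≠ 0) (hb : b ≠ 0) (w z : V3) :
    (rot (a, b) (rot (a, b) (w, z))).1 = -N2 a b • w := by
  have h1 := norm_pos_iff.2 ha
  have h2 := norm_pos_iff.2 hb
  simp only [rot_apply, rotPart_apply, N2_comm b a, ContinuousLinearMap.coe_fst',
    ContinuousLinearMap.coe_snd', real_inner_comm a b, inner_add_right, inner_sub_right,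
    inner_smul_right, inner_neg_right, real_inner_self_eq_norm_sq]
  ext i
  simp only [PiLp.add_apply, PiLp.sub_apply, PiLp.smul_apply, PiLp.neg_apply, smul_eq_mul, N2]
  generalize ‖a‖ = u at *
  generalize ‖b‖ = v at *
  field_simp
  ring

theorem rot_rot_snd {a b : V3} (ha : a ≠ 0) (hb : b ≠ 0) (w z : V3) :
    (rot (a, b) (rot (a, b) (w, z))).2 = -N2 a b • z := by
  have h1 := norm_pos_iff.2 ha
  have h2 := norm_pos_iff.2 hb
  simp only [rot_apply, rotPart_apply, N2_comm b a, ContinuousLinearMap.coe_fst',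
    ContinuousLinearMap.coe_snd', real_inner_comm a b, inner_add_right, inner_sub_right,
    inner_smul_right, inner_neg_right, real_inner_self_eq_norm_sq]
  ext i
  simp only [PiLp.add_apply, PiLp.sub_apply, PiLp.smul_apply, PiLp.neg_apply, smul_eq_mul, N2]
  generalize ‖a‖ = u at *
  generalize ‖b‖ = v at *
  field_simp
  ring

theorem rot_rot {m : Bivector} (hm : m ∈ smoothLocus) (W : Bivector) :
    rot m (rot m W) = -N2 m.1 m.2 • W :=
  Prod.ext (rot_rot_fst hm.1 hm.2 W.1 W.2) (rot_rot_snd hm.1 hm.2 W.1 W.2)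

set_option maxHeartbeats 2000000 in
theorem metric_rot {m : Bivector} (hm : m ∈ smoothLocus) (W Z : Bivector) :
    metric m (rot m W) Z = sigma m ![W, Z] := by
  obtain ⟨a, b⟩ := m
  have h1 := norm_pos_iff.2 hm.1
  have h2 := norm_pos_iff.2 hm.2
  have hN := N2_pos hm.1 hm.2
  simp only at h1 h2 hN
  simp only [metric_apply, sigma_apply, dNormFst_apply, dNormSnd_apply, angular_apply, shape_apply,
    rot_apply, rotPart_apply, N2_comm b a, ContinuousLinearMap.coe_fst',
    ContinuousLinearMap.coe_snd', real_inner_comm a b, inner_add_right, inner_sub_right,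
    inner_smul_right, inner_neg_right, inner_add_left, inner_sub_left, real_inner_smul_left,
    inner_neg_left, real_inner_self_eq_norm_sq]
  have hN2 : N2 a b = 6 * ‖a‖ * ‖b‖ - 2 * inner ℝ a b := rfl
  -- Eliminating a·b in favour of N₂ lets the factor N₂⁻¹ of the metric cancel.
  have hr : inner ℝ a b = 3 * ‖a‖ * ‖b‖ - N2 a b / 2 := by linarith
  rw [hr]
  generalize N2 a b = N at *
  generalize ‖a‖ = u at *
  generalize ‖b‖ = v at *
  field_simp
  ring

/-- Testing against multiples of a and b gives linear equations for p = du(W), q = dv(W) and s =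
(𝐮·d𝐯 − 𝐯·d𝐮)(W). The factor 3uv − a·b = N₂/2 > 0 forces all three to vanish, and only (u + v) Σ duᵢ
∧ dvᵢ is left to act on W. -/
theorem sigma_nondegenerate {m : Bivector} (hm : m ∈ smoothLocus) {W : Bivector}
    (hW : ∀ Z, sigma m ![W, Z] = 0) : W = 0 := by
  obtain ⟨a, b⟩ := m
  obtain ⟨w, z⟩ := W
  have h1 := norm_pos_iff.2 hm.1
  have h2 := norm_pos_iff.2 hm.2
  have hr := real_inner_le_norm a b
  simp only at h1 h2
  simp only [sigma_apply, dNormFst_apply, dNormSnd_apply, angular_apply] at hW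
  have e1 (c : V3) := hW (0, c)
  have e2 (c : V3) := hW (c, 0)
  simp only [inner_zero_right, mul_zero, sub_zero, zero_sub, add_zero, zero_add, zero_mul] at e1 e2
  have e3 := e1 a
  have e4 := e1 b
  have e5 := e2 a
  have e6 := e2 b
  simp only [real_inner_self_eq_norm_sq, real_inner_comm a b] at e3 e4 e5 e6
  rw [real_inner_comm a w] at e3
  rw [real_inner_comm b w] at e4
  rw [real_inner_comm a z] at e5
  rw [real_inner_comm b z] at e6
  have hP : inner ℝ a w = ‖a‖ * (‖a‖⁻¹ * inner ℝ a w) := by field_simp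
  have hS : inner ℝ b z = ‖b‖ * (‖b‖⁻¹ * inner ℝ b z) := by field_simp
  generalize hp : ‖a‖⁻¹ * inner ℝ a w = p at *
  generalize hq : ‖b‖⁻¹ * inner ℝ b z = q at *
  generalize hs : inner ℝ a z - inner ℝ b w = s at *
  rw [hP] at e3
  rw [hS] at e6
  clear hp hq hP hS hW
  have hpq : p + q = 0 := by
    have h : (p + q) * ((‖a‖ + ‖b‖) * (3 * ‖a‖ * ‖b‖ - inner ℝ a b)) = 0 := by
      field_simp at e3 e6
      linear_combination e3 - e6
    refine (mul_eq_zero.1 h).resolve_right (mul_pos (by positivity) ?_).ne'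
    nlinarith [mul_pos h1 h2]
  obtain rfl : q = -p := by linarith
  have hs3 : s = -p * (‖a‖ + ‖b‖) / 3 := by
    have h : (‖a‖ + ‖b‖) * (s + p * (‖a‖ + ‖b‖) / 3) = 0 := by
      field_simp at e4 e5 ⊢
      linear_combination (-1 : ℝ) * e4 - e5 - 2 * (‖a‖ + ‖b‖) * hs
    have := (mul_eq_zero.1 h).resolve_left (by positivity)
    linarith
  have hp : p = 0 := by
    have h : p * ((‖a‖ + ‖b‖) * (3 * ‖a‖ * ‖b‖ - inner ℝ a b)) = 0 := by
      rw [hs3] at e3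
      field_simp at e3
      linear_combination 1 / 2 * e3
    refine (mul_eq_zero.1 h).resolve_right (mul_pos (by positivity) ?_).ne'
    nlinarith [mul_pos h1 h2]
  subst hp
  have hs0 : s = 0 := by rw [hs3]; ring
  have f1 := e1 w
  have f2 := e2 z
  simp only [hs0] at f1 f2
  have g1 : inner ℝ w w = 0 := by
    refine (mul_eq_zero.1 (?_ : (‖a‖ + ‖b‖) * inner ℝ w w = 0)).resolve_left (by positivity)
    linear_combination f1
  have g2 : inner ℝ z z = 0 := by
    refine (mul_eq_zero.1 (?_ : (‖a‖ + ‖b‖) * inner ℝ z z = 0)).resolve_left (by positivity)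
    linear_combination -f2
  rw [inner_self_eq_zero] at g1 g2
  rw [g1, g2]
  rfl

theorem metric_symm (m W Z : Bivector) : metric m W Z = metric m Z W := by
  rw [metric_apply, metric_apply, real_inner_comm W.1, real_inner_comm W.2,
    real_inner_comm (shape m W) (shape m Z)]
  ring

/-- Nondegeneracy is inherited from σ, since g₂(W, rot Z) = σ(Z, W); positivity of g₂ is not needed.
-/
theorem metric_nondegenerate {m : Bivector} (hm : m ∈ smoothLocus) {W : Bivector}
    (hW : ∀ Z, metric m W Z = 0) : W = 0 :=
  sigma_nondegenerate hm fun Z => by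
    have h := hW (rot m Z)
    rw [metric_symm, metric_rot hm, sigma_apply] at h
    rw [sigma_apply, real_inner_comm Z.2, real_inner_comm Z.1]
    linear_combination -h

/-! ### Surjectivity of `Q` and its differential; uniqueness of the induced tensors. -/

/-- The Hopf map is onto. The phase is normalised so that the first spinor component is real, with
square (‖a‖ + a₀)/2; where this vanishes, on the negative half-axis, the spinor (0, √‖a‖) serves. -/
theorem exists_spinor {a : V3} (ha : a ≠ 0) : ∃ p q r s : ℝ,
    a 0 = p ^ 2 + q ^ 2 - r ^ 2 - s ^ 2 ∧ a 1 = 2 * (p * r + q * s) ∧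
      a 2 = 2 * (p * s - q * r) := by
  have hn := norm_pos_iff.2 ha
  have hsq : ‖a‖ ^ 2 = a 0 ^ 2 + a 1 ^ 2 + a 2 ^ 2 := by
    rw [← real_inner_self_eq_norm_sq, inner_V3]
    ring
  by_cases h : ‖a‖ + a 0 = 0
  · have h1 : a 1 ^ 2 + a 2 ^ 2 = 0 := by
      rw [show a 0 = -‖a‖ by linarith] at hsq
      linarith
    have h2 : a 1 = 0 := by nlinarith [sq_nonneg (a 1), sq_nonneg (a 2)]
    have h3 : a 2 = 0 := by nlinarith [sq_nonneg (a 1), sq_nonneg (a 2)]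
    refine ⟨0, 0, √‖a‖, 0, ?_, ?_, ?_⟩
    · rw [Real.sq_sqrt hn.le]
      linarith
    · simp [h2]
    · simp [h3]
  · have h0 : 0 < ‖a‖ + a 0 := by
      refine lt_of_le_of_ne ?_ (Ne.symm h)
      nlinarith [sq_nonneg (a 1), sq_nonneg (a 2)]
    have h1 : 0 < √((‖a‖ + a 0) / 2) := Real.sqrt_pos.2 (by linarith)
    have h2 : √((‖a‖ + a 0) / 2) ^ 2 = (‖a‖ + a 0) / 2 := Real.sq_sqrt (by linarith)
    generalize √((‖a‖ + a 0) / 2) = t at *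
    refine ⟨t, 0, a 1 / (2 * t), a 2 / (2 * t), ?_, ?_, ?_⟩
    · have : a 1 ^ 2 + a 2 ^ 2 = (‖a‖ - a 0) * (2 * t ^ 2) := by
        rw [h2]
        linear_combination -hsq
      have h3 : (a 1 / (2 * t)) ^ 2 + (a 2 / (2 * t)) ^ 2 = (‖a‖ - a 0) / 2 := by
        field_simp
        linear_combination this
      linear_combination h3 - h2
    · field_simp
      ring
    · field_simp
      ring

theorem exists_Q_eq {m : Bivector} (hm : m ∈ smoothLocus) : ∃ x, Q x = m := by
  obtain ⟨p, q, r, s, h1, h2, h3⟩ := exists_spinor hm.1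
  obtain ⟨p', q', r', s', h1', h2', h3'⟩ := exists_spinor hm.2
  refine ⟨!₂[p, q, p', q', r, s, r', s'], Prod.ext (PiLp.ext fun i => ?_) (PiLp.ext fun i => ?_)⟩
    <;> fin_cases i <;> simp [Q, *]

theorem dQ_surjective {x : V8} (hx : Q x ∈ smoothLocus) (W : Bivector) : ∃ p, dQ x p = W := by
  obtain ⟨h1, h2⟩ := norm_Q_pos hx
  -- On each side the witness is the Pauli matrix of the component of W applied to the spinor,
  -- divided by twice the norm.
  refine ⟨!₂[
    (W.1 0 * x 0 + W.1 1 * x 4 + W.1 2 * x 5) / (2 * (x 0 ^ 2 + x 1 ^ 2 + x 4 ^ 2 + x 5 ^ 2)),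
    (W.1 0 * x 1 + W.1 1 * x 5 - W.1 2 * x 4) / (2 * (x 0 ^ 2 + x 1 ^ 2 + x 4 ^ 2 + x 5 ^ 2)),
    (W.2 0 * x 2 + W.2 1 * x 6 + W.2 2 * x 7) / (2 * (x 2 ^ 2 + x 3 ^ 2 + x 6 ^ 2 + x 7 ^ 2)),
    (W.2 0 * x 3 + W.2 1 * x 7 - W.2 2 * x 6) / (2 * (x 2 ^ 2 + x 3 ^ 2 + x 6 ^ 2 + x 7 ^ 2)),
    (W.1 1 * x 0 - W.1 2 * x 1 - W.1 0 * x 4) / (2 * (x 0 ^ 2 + x 1 ^ 2 + x 4 ^ 2 + x 5 ^ 2)),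
    (W.1 1 * x 1 + W.1 2 * x 0 - W.1 0 * x 5) / (2 * (x 0 ^ 2 + x 1 ^ 2 + x 4 ^ 2 + x 5 ^ 2)),
    (W.2 1 * x 2 - W.2 2 * x 3 - W.2 0 * x 6) / (2 * (x 2 ^ 2 + x 3 ^ 2 + x 6 ^ 2 + x 7 ^ 2)),
    (W.2 1 * x 3 + W.2 2 * x 2 - W.2 0 * x 7) / (2 * (x 2 ^ 2 + x 3 ^ 2 + x 6 ^ 2 + x 7 ^ 2))],
    Prod.ext (PiLp.ext fun i => ?_) (PiLp.ext fun i => ?_)⟩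
    <;> fin_cases i <;> simp [dQ] <;> field_simp <;> ring

/-- The induced almost complex structure. -/
def complexStructure (m : Bivector) : Bivector →L[ℝ] Bivector := (√(N2 m.1 m.2))⁻¹ • rot m

theorem sigma_comp_fderiv_Q {x : V8} (hx : Q x ∈ smoothLocus) :
    (sigma (Q x)).compContinuousLinearMap (fderiv ℝ Q x) = (phi x).curryLeft (X x) := by
  ext v
  have h : ⇑(fderiv ℝ Q x) ∘ v = ![dQ x (v 0), dQ x (v 1)] := by
    ext1 i
    fin_cases i <;> simp [fderiv_Q_apply]
  have h2 : Matrix.vecCons (X x) v = ![X x, v 0, v 1] := by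
    ext1 i
    fin_cases i <;> rfl
  rw [ContinuousAlternatingMap.compContinuousLinearMap_apply, h, sigma_dQ hx,
    ContinuousAlternatingMap.curryLeft_apply_apply, h2]

theorem coneMetric_decomposition {x : V8} (hx : Q x ∈ smoothLocus) (p q : V8) :
    coneMetric x p q = metric (Q x) (dQ x p) (dQ x q) +
      1 / 4 * coneMetric x (X x) (X x) * (Theta x p * Theta x q) := by
  have hN := N2_pos hx.1 hx.2
  rw [Theta, Theta, coneMetric_X_X hx, coneMetric_eq hx p q]
  field_simp
  ring

theorem isInducedStructure : IsInducedStructure metric sigma complexStructure where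
  pullback_sigma x hx := sigma_comp_fderiv_Q hx
  pullback_metric x hx p q := by
    rw [fderiv_Q_apply, fderiv_Q_apply, coneMetric_decomposition hx]
  sigma_eq x hx W Z := by
    have hN := Real.sqrt_pos.2 (N2_pos hx.1 hx.2)
    rw [coneMetric_X_X hx, ← metric_rot hx, complexStructure, smul_apply, map_smul, smul_apply,
      smul_eq_mul]
    field_simp

/-- The conditions on the induced tensors determine the almost complex structure. -/
theorem IsInducedStructure.eq_complexStructure
    {g : Bivector → Bivector →L[ℝ] Bivector →L[ℝ] ℝ} {σ : Bivector → Bivector [⋀^Fin 2]→L[ℝ] ℝ}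
    {J : Bivector → Bivector →L[ℝ] Bivector} (h : IsInducedStructure g σ J) {m : Bivector}
    (hm : m ∈ smoothLocus) : J m = complexStructure m := by
  obtain ⟨x, rfl⟩ := exists_Q_eq hm
  have hN := Real.sqrt_pos.2 (N2_pos hm.1 hm.2)
  -- Every tangent vector is a value of dQ, so the pulled-back equations determine g and σ.
  have hg (W Z : Bivector) : g (Q x) W Z = metric (Q x) W Z := by
    obtain ⟨p, rfl⟩ := dQ_surjective hm W
    obtain ⟨q, rfl⟩ := dQ_surjective hm Z
    have h1 := h.pullback_metric x hm p q
    rw [coneMetric_decomposition hm, fderiv_Q_apply, fderiv_Q_apply] at h1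
    linarith
  have hσ (W Z : Bivector) : σ (Q x) ![W, Z] = sigma (Q x) ![W, Z] := by
    obtain ⟨p, rfl⟩ := dQ_surjective hm W
    obtain ⟨q, rfl⟩ := dQ_surjective hm Z
    have h1 := congrArg (fun f => f ![p, q])
      ((h.pullback_sigma x hm).trans (sigma_comp_fderiv_Q hm).symm)
    have h2 : ⇑(fderiv ℝ Q x) ∘ ![p, q] = ![dQ x p, dQ x q] := by
      ext1 i
      fin_cases i <;> simp [fderiv_Q_apply]
    simpa only [ContinuousAlternatingMap.compContinuousLinearMap_apply, h2] using h1
  refine ContinuousLinearMap.ext fun W => sub_eq_zero.1 (metric_nondegenerate hm fun Z => ?_)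
  have h1 := h.sigma_eq x hm W Z
  have h2 := isInducedStructure.sigma_eq x hm W Z
  rw [hσ, hg] at h1
  rw [coneMetric_X_X hm] at h1 h2
  rw [map_sub, sub_apply, sub_eq_zero]
  exact mul_left_cancel₀ hN.ne' (h1.symm.trans h2)

theorem complexStructure_sq {m : Bivector} (hm : m ∈ smoothLocus) (W : Bivector) :
    complexStructure m (complexStructure m W) = -W := by
  have hN := N2_pos hm.1 hm.2
  rw [complexStructure, smul_apply, smul_apply, map_smul, rot_rot hm, smul_smul, smul_smul,
    ← mul_inv, Real.mul_self_sqrt hN.le, mul_neg, inv_mul_cancel₀ hN.ne', neg_one_smul]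

/-! ### Evaluation of triple products -/

/-- The coordinate `1`-forms of a vector-valued `1`-form. -/
def coords (S : Bivector →L[ℝ] V3) (i : Fin 3) : Bivector →L[ℝ] ℝ :=
  (EuclideanSpace.proj i : V3 →L[ℝ] ℝ).comp S

@[simp]
theorem coords_apply (S : Bivector →L[ℝ] V3) (i : Fin 3) (W : Bivector) :
    coords S i W = S W i := rfl

theorem du_eq : du = coords (ContinuousLinearMap.fst ℝ V3 V3) := rfl

theorem dv_eq : dv = coords (ContinuousLinearMap.snd ℝ V3 V3) := rfl

theorem sum_perm_fin_three {M : Type*} [AddCommGroup M] (F : Fin 3 → Fin 3 → Fin 3 → M) :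
    ∑ s : Equiv.Perm (Fin 3), (Equiv.Perm.sign s : ℤ) • F (s 0) (s 1) (s 2) =
      F 0 1 2 - F 0 2 1 - F 1 0 2 + F 1 2 0 + F 2 0 1 - F 2 1 0 := by
  have h : (Finset.univ : Finset (Equiv.Perm (Fin 3))) = {1, Equiv.swap 1 2, Equiv.swap 0 1,
      Equiv.swap 0 1 * Equiv.swap 1 2, Equiv.swap 1 2 * Equiv.swap 0 1, Equiv.swap 0 2} := by
    decide
  rw [h, Finset.sum_insert (by decide), Finset.sum_insert (by decide),
    Finset.sum_insert (by decide), Finset.sum_insert (by decide), Finset.sum_insert (by decide),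
    Finset.sum_singleton]
  have e1 : Equiv.swap (1 : Fin 3) 2 0 = 0 := by decide
  have e2 : Equiv.swap (0 : Fin 3) 1 2 = 2 := by decide
  have e3 : Equiv.swap (0 : Fin 3) 2 1 = 1 := by decide
  simp [e1, e2, e3]
  abel

/-- An arbitrary vector-valued form S lets one evaluation serve for d𝐮 and d𝐯, hence for both halves
of ψ±, which differ by an interchange. -/
theorem dot_apply (a : V3) (S : Bivector →L[ℝ] V3) (W : Bivector) :
    dot a (coords S) W = inner ℝ a (S W) := by
  simp [dot, inner_V3, Fin.sum_univ_three]

theorem triple2_apply (a : V3) (S : Bivector →L[ℝ] V3) (W Z : Bivector) :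
    triple2 a (coords S) (coords S) ![W, Z] = 2 * det3 a (S W) (S Z) := by
  rw [triple2, sum_perm_fin_three fun i j k => a i • wedge (coords S j) (oneForm (coords S k))]
  simp only [ContinuousAlternatingMap.add_apply, ContinuousAlternatingMap.sub_apply,
    ContinuousAlternatingMap.smul_apply, wedge_oneForm_apply, coords_apply, smul_eq_mul,
    Matrix.cons_val_zero, Matrix.cons_val_one, det3]
  ring

theorem triple3_apply (S T : Bivector →L[ℝ] V3) (W Z Y : Bivector) :
    triple3 (coords S) (coords T) (coords T) ![W, Z, Y] =
      2 * (det3 (S W) (T Z) (T Y) + det3 (T W) (S Z) (T Y) + det3 (T W) (T Z) (S Y)) := by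
  rw [triple3, sum_perm_fin_three fun i j k =>
    wedge (coords S i) (wedge (coords T j) (oneForm (coords T k)))]
  simp only [ContinuousAlternatingMap.add_apply, ContinuousAlternatingMap.sub_apply,
    wedge_apply_three, wedge_oneForm_apply, coords_apply, Matrix.cons_val, det3]
  ring

theorem wedge_triple2_apply (α : Bivector →L[ℝ] ℝ) (a : V3) (S : Bivector →L[ℝ] V3)
    (W Z Y : Bivector) : wedge α (triple2 a (coords S) (coords S)) ![W, Z, Y] =
      2 * (α W * det3 a (S Z) (S Y) - α Z * det3 a (S W) (S Y) + α Y * det3 a (S W) (S Z)) := by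
  simp only [wedge_apply_three, Matrix.cons_val, triple2_apply]
  ring

/-- The value of the form `psiPlusPart a b` on three tangent vectors with components `A i` on the
side of `a` and `B i` on the side of `b`. -/
def psiPlusVal (a b A₀ A₁ A₂ B₀ B₁ B₂ : V3) : ℝ :=
  ‖b‖ * (N2 a b + 4 * ‖b‖ ^ 2) * det3 A₀ A₁ A₂
  - 2 * (‖b‖ * (4 * ‖a‖ ^ 2 + 3 * ‖a‖ * ‖b‖ + inner ℝ a b)) *
      (det3 B₀ A₁ A₂ + det3 A₀ B₁ A₂ + det3 A₀ A₁ B₂)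
  + 2 * (((‖a‖ + 2 * ‖b‖) * inner ℝ b B₀ + ‖b‖ * inner ℝ a B₀) * det3 a A₁ A₂
    - ((‖a‖ + 2 * ‖b‖) * inner ℝ b B₁ + ‖b‖ * inner ℝ a B₁) * det3 a A₀ A₂
    + ((‖a‖ + 2 * ‖b‖) * inner ℝ b B₂ + ‖b‖ * inner ℝ a B₂) * det3 a A₀ A₁)
  + 2 * ((‖b‖ * inner ℝ a B₀ - ‖a‖ * inner ℝ b B₀) * det3 b A₁ A₂
    - (‖b‖ * inner ℝ a B₁ - ‖a‖ * inner ℝ b B₁) * det3 b A₀ A₂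
    + (‖b‖ * inner ℝ a B₂ - ‖a‖ * inner ℝ b B₂) * det3 b A₀ A₁)

theorem psiPlusPart_apply (a b : V3) (S T : Bivector →L[ℝ] V3) (W Z Y : Bivector) :
    psiPlusPart a b (coords S) (coords T) ![W, Z, Y] =
      psiPlusVal a b (S W) (S Z) (S Y) (T W) (T Z) (T Y) := by
  simp only [psiPlusPart, ContinuousAlternatingMap.add_apply, ContinuousAlternatingMap.sub_apply,
    ContinuousAlternatingMap.smul_apply, triple3_apply, wedge_triple2_apply, add_apply, sub_apply,
    smul_apply, dot_apply, smul_eq_mul, psiPlusVal]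
  ring

/-- The value of the form `psiMinusPart a b` on three tangent vectors with components `A i` on the
side of `a` and `B i` on the side of `b`. -/
def psiMinusVal (a b A₀ A₁ A₂ B₀ B₁ B₂ : V3) : ℝ :=
  2 * (N2 a b + 4 * ‖b‖ ^ 2) * det3 A₀ A₁ A₂
  + 2 * ((3 + ‖a‖ * ‖b‖⁻¹) * inner ℝ a b - 3 * ‖a‖ ^ 2 - 5 * ‖a‖ * ‖b‖) *
      (det3 A₀ B₁ B₂ + det3 B₀ A₁ B₂ + det3 B₀ B₁ A₂)
  + 4 * (inner ℝ b B₀ * det3 a A₁ A₂ - inner ℝ b B₁ * det3 a A₀ A₂ + inner ℝ b B₂ * det3 a A₀ A₁)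
  + 4 * (‖a‖ * ‖b‖⁻¹) *
    (inner ℝ b A₀ * det3 b B₁ B₂ - inner ℝ b A₁ * det3 b B₀ B₂ + inner ℝ b A₂ * det3 b B₀ B₁)
  + 2 * (((1 - ‖a‖ * ‖b‖⁻¹) * inner ℝ b B₀ + (3 + ‖b‖ * ‖a‖⁻¹) * inner ℝ a B₀) * det3 b A₁ A₂
    - ((1 - ‖a‖ * ‖b‖⁻¹) * inner ℝ b B₁ + (3 + ‖b‖ * ‖a‖⁻¹) * inner ℝ a B₁) * det3 b A₀ A₂
    + ((1 - ‖a‖ * ‖b‖⁻¹) * inner ℝ b B₂ + (3 + ‖b‖ * ‖a‖⁻¹) * inner ℝ a B₂) * det3 b A₀ A₁)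

theorem psiMinusPart_apply (a b : V3) (S T : Bivector →L[ℝ] V3) (W Z Y : Bivector) :
    psiMinusPart a b (coords S) (coords T) ![W, Z, Y] =
      psiMinusVal a b (S W) (S Z) (S Y) (T W) (T Z) (T Y) := by
  simp only [psiMinusPart, ContinuousAlternatingMap.add_apply, ContinuousAlternatingMap.smul_apply,
    triple3_apply, wedge_triple2_apply, add_apply, smul_apply, dot_apply, smul_eq_mul, psiMinusVal]
  ring

/-- The form `8uv ψ⁺`. -/
def scaledPlus (m : Bivector) : Bivector [⋀^Fin 3]→L[ℝ] ℝ :=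
  psiPlusPart m.1 m.2 du dv + psiPlusPart m.2 m.1 dv du

/-- The form `4 N₂ ^ (1/2) ψ⁻`. -/
def scaledMinus (m : Bivector) : Bivector [⋀^Fin 3]→L[ℝ] ℝ :=
  psiMinusPart m.1 m.2 du dv - psiMinusPart m.2 m.1 dv du

theorem scaledPlus_apply (m W Z Y : Bivector) : scaledPlus m ![W, Z, Y] =
    psiPlusVal m.1 m.2 W.1 Z.1 Y.1 W.2 Z.2 Y.2 + psiPlusVal m.2 m.1 W.2 Z.2 Y.2 W.1 Z.1 Y.1 := by
  rw [scaledPlus, du_eq, dv_eq, ContinuousAlternatingMap.add_apply, psiPlusPart_apply,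
    psiPlusPart_apply]
  rfl

theorem scaledMinus_apply (m W Z Y : Bivector) : scaledMinus m ![W, Z, Y] =
    psiMinusVal m.1 m.2 W.1 Z.1 Y.1 W.2 Z.2 Y.2
      - psiMinusVal m.2 m.1 W.2 Z.2 Y.2 W.1 Z.1 Y.1 := by
  rw [scaledMinus, du_eq, dv_eq, ContinuousAlternatingMap.sub_apply, psiMinusPart_apply,
    psiMinusPart_apply]
  rfl

theorem norm_eq_of_sq {a : V3} {c : ℝ} (hc : 0 ≤ c) (h : a 0 ^ 2 + a 1 ^ 2 + a 2 ^ 2 = c ^ 2) :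
    ‖a‖ = c := by
  rw [← sq_eq_sq₀ (norm_nonneg _) hc, ← h, ← real_inner_self_eq_norm_sq, inner_V3]
  ring

set_option maxHeartbeats 4000000 in
/-- `ψ⁺ (J W, Z, Y) = -ψ⁻ (W, Z, Y)` for bivectors in normal form, without denominators. -/
theorem scaledPlus_rot_normalForm {p s t : ℝ} (hp : 0 < p) (hst : 0 < s ^ 2 + t ^ 2)
    (W Z Y : Bivector) :
    scaledPlus (!₂[p, 0, 0], !₂[s ^ 2 - t ^ 2, 2 * s * t, 0])
      ![rot (!₂[p, 0, 0], !₂[s ^ 2 - t ^ 2, 2 * s * t, 0]) W, Z, Y] =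
    -2 * p * (s ^ 2 + t ^ 2) *
      scaledMinus (!₂[p, 0, 0], !₂[s ^ 2 - t ^ 2, 2 * s * t, 0]) ![W, Z, Y] := by
  set m : Bivector := (!₂[p, 0, 0], !₂[s ^ 2 - t ^ 2, 2 * s * t, 0]) with hm
  have h1 : ‖m.1‖ = p := norm_eq_of_sq hp.le (by simp [hm])
  have h2 : ‖m.2‖ = s ^ 2 + t ^ 2 := norm_eq_of_sq hst.le (by simp [hm]; ring)
  -- Both sides alternate in Z, Y, so pairs of basis vectors suffice; W stays general.
  let f : Bivector [⋀^Fin 2]→ₗ[ℝ] ℝ := ((scaledPlus m).curryLeft (rot m W)).toAlternatingMap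
  let g : Bivector [⋀^Fin 2]→ₗ[ℝ] ℝ :=
    (-2 * p * (s ^ 2 + t ^ 2)) • ((scaledMinus m).curryLeft W).toAlternatingMap
  suffices hfg : f = g by
    have h := congrArg (fun k => k ![Z, Y]) hfg
    simpa [f, g] using h
  let e := (EuclideanSpace.basisFun (Fin 3) ℝ).toBasis.prod
    (EuclideanSpace.basisFun (Fin 3) ℝ).toBasis
  refine e.ext_alternating fun v _ => ?_
  have hv : (fun i => e (v i)) = ![e (v 0), e (v 1)] := by
    ext1 i
    fin_cases i <;> rfl
  rw [hv]
  change scaledPlus m ![_, _, _] = (-2 * p * (s ^ 2 + t ^ 2)) • scaledMinus m ![_, _, _]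
  generalize v 0 = i
  generalize v 1 = j
  rw [scaledPlus_apply, scaledMinus_apply]
  simp only [rot_apply, rotPart_apply, psiPlusVal, psiMinusVal, h1, h2, N2, inner_V3, det3]
  rcases i with i | i <;> rcases j with j | j <;> fin_cases i <;> fin_cases j <;> simp [hm, e] <;>
    field_simp <;> ring

/-! ### Reduction to a normal form by rotations -/

/-- A pair of vectors spans a plane together with a vector orthogonal to the first. -/
theorem exists_orthogonal (e b : V3) (he : inner ℝ e e = (1 : ℝ)) :
    ∃ d : V3, inner ℝ d d = (1 : ℝ) ∧ inner ℝ e d = (0 : ℝ) ∧ ∃ l k : ℝ, b = l • e + k • d := by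
  obtain ⟨d, hd, hed, l, k, hb⟩ : ∃ d : V3, d ≠ 0 ∧ inner ℝ e d = (0 : ℝ) ∧
      ∃ l k : ℝ, b = l • e + k • d := by
    by_cases h : b - inner ℝ e b • e = 0
    · have hb : b = inner ℝ e b • e := sub_eq_zero.1 h
      -- If b is parallel to e, any vector orthogonal to e will do: (−e₁, e₀, 0), unless e lies on
      -- the third axis.
      by_cases h2 : e 0 = 0 ∧ e 1 = 0
      · refine ⟨!₂[1, 0, 0], fun h3 => ?_, by simp [inner_V3, h2.1], inner ℝ e b, 0, by simpa⟩
        simpa using congrArg (fun v : V3 => v 0) h3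
      · refine ⟨!₂[-e 1, e 0, 0], fun h3 => h2 ⟨?_, ?_⟩, by simp [inner_V3]; ring, inner ℝ e b, 0,
          by simpa⟩
        · simpa using congrArg (fun v : V3 => v 1) h3
        · simpa using congrArg (fun v : V3 => v 0) h3
    · refine ⟨_, h, ?_, inner ℝ e b, 1, by simp⟩
      rw [inner_sub_right, inner_smul_right, he]
      ring
  have hn := norm_pos_iff.2 hd
  refine ⟨‖d‖⁻¹ • d, ?_, ?_, l, k * ‖d‖, ?_⟩
  · rw [real_inner_smul_left, inner_smul_right, real_inner_self_eq_norm_sq]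
    field_simp
  · rw [inner_smul_right, hed, mul_zero]
  · rw [smul_smul, mul_assoc, mul_inv_cancel₀ hn.ne', mul_one]
    exact hb

/-- The matrix with columns e, d, e × d is orthogonal with determinant 1; orientation matters
because ψ± contain triple products. -/
theorem exists_rotation {e d : V3} (he : inner ℝ e e = (1 : ℝ)) (hd : inner ℝ d d = (1 : ℝ))
    (hed : inner ℝ e d = (0 : ℝ)) : ∃ L : V3 ≃ₗᵢ[ℝ] V3,
      (∀ x y z, det3 (L x) (L y) (L z) = det3 x y z) ∧
      ∀ l k : ℝ, L !₂[l, k, 0] = l • e + k • d := by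
  let c : V3 := !₂[e 1 * d 2 - e 2 * d 1, e 2 * d 0 - e 0 * d 2, e 0 * d 1 - e 1 * d 0]
  rw [inner_V3] at he hd hed
  -- The determinant is |e × d|², which is 1 by Lagrange's identity.
  have hdet : det3 e d c = 1 := by
    simp [det3, c]
    linear_combination he * (d 0 * d 0 + d 1 * d 1 + d 2 * d 2) + hd -
      hed * (e 0 * d 0 + e 1 * d 1 + e 2 * d 2)
  let f : V3 →ₗ[ℝ] V3 :=
    { toFun x := x 0 • e + x 1 • d + x 2 • c
      map_add' x y := by
        simp only [PiLp.add_apply]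
        module
      map_smul' r x := by
        simp only [PiLp.smul_apply, smul_eq_mul, RingHom.id_apply]
        module }
  have hf (x : V3) : f x = x 0 • e + x 1 • d + x 2 • c := rfl
  have hcc : c 0 * c 0 + c 1 * c 1 + c 2 * c 2 = 1 := by
    simp [c]
    linear_combination he * (d 0 * d 0 + d 1 * d 1 + d 2 * d 2) + hd -
      hed * (e 0 * d 0 + e 1 * d 1 + e 2 * d 2)
  have hec : e 0 * c 0 + e 1 * c 1 + e 2 * c 2 = 0 := by
    simp [c]
    ring
  have hdc : d 0 * c 0 + d 1 * c 1 + d 2 * c 2 = 0 := by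
    simp [c]
    ring
  have hnorm (x : V3) : ‖f x‖ = ‖x‖ := by
    rw [← sq_eq_sq₀ (norm_nonneg _) (norm_nonneg _), ← real_inner_self_eq_norm_sq,
      ← real_inner_self_eq_norm_sq, inner_V3, inner_V3, hf]
    simp only [PiLp.add_apply, PiLp.smul_apply, smul_eq_mul]
    linear_combination x 0 ^ 2 * he + x 1 ^ 2 * hd + x 2 ^ 2 * hcc + 2 * x 0 * x 1 * hed +
      2 * x 0 * x 2 * hec + 2 * x 1 * x 2 * hdc
  refine ⟨LinearIsometry.toLinearIsometryEquiv ⟨f, hnorm⟩ rfl, fun x y z => ?_, fun l k => ?_⟩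
  · change det3 (f x) (f y) (f z) = _
    have : det3 (f x) (f y) (f z) = det3 x y z * det3 e d c := by
      simp only [hf, det3, PiLp.add_apply, PiLp.smul_apply, smul_eq_mul]
      ring
    rw [this, hdet, mul_one]
  · change f _ = _
    simp [hf]

/-- Two vectors can be rotated into a coordinate plane, the first onto a positive half-axis. -/
theorem exists_normalForm {m : Bivector} (hm : m ∈ smoothLocus) : ∃ L : V3 ≃ₗᵢ[ℝ] V3,
    (∀ x y z, det3 (L x) (L y) (L z) = det3 x y z) ∧
    ∃ p s t : ℝ, 0 < p ∧ 0 < s ^ 2 + t ^ 2 ∧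
      m = (L !₂[p, 0, 0], L !₂[s ^ 2 - t ^ 2, 2 * s * t, 0]) := by
  obtain ⟨a, b⟩ := m
  have hn := norm_pos_iff.2 hm.1
  simp only at hn
  have he : inner ℝ (‖a‖⁻¹ • a) (‖a‖⁻¹ • a) = (1 : ℝ) := by
    rw [real_inner_smul_left, inner_smul_right, real_inner_self_eq_norm_sq]
    field_simp
  obtain ⟨d, hd, hed, l, k, hb⟩ := exists_orthogonal (‖a‖⁻¹ • a) b he
  obtain ⟨L, hdet, hL⟩ := exists_rotation he hd hed
  -- A complex square root of l + ik provides s and t; with b written as (s² − t², 2st) its norm s²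
  -- + t² is polynomial.
  obtain ⟨z, hz⟩ := IsAlgClosed.exists_pow_nat_eq (⟨l, k⟩ : ℂ) two_pos
  have h1 : z.re ^ 2 - z.im ^ 2 = l := by
    have := congrArg Complex.re hz
    rw [pow_two, Complex.mul_re] at this
    simp only at this
    linarith
  have h2 : 2 * z.re * z.im = k := by
    have := congrArg Complex.im hz
    rw [pow_two, Complex.mul_im] at this
    simp only at this
    linarith
  refine ⟨L, hdet, ‖a‖, z.re, z.im, hn, ?_, ?_⟩
  · refine lt_of_le_of_ne (by positivity) fun h => hm.2 ?_
    have h3 : z.re = 0 := by nlinarith [sq_nonneg z.re, sq_nonneg z.im]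
    have h4 : z.im = 0 := by nlinarith [sq_nonneg z.re, sq_nonneg z.im]
    change b = 0
    rw [hb, ← h1, ← h2, h3, h4]
    simp
  · rw [h1, h2, hL, hL, ← hb, smul_smul, mul_inv_cancel₀ hn.ne']
    simp

theorem psiPlusVal_map (L : V3 ≃ₗᵢ[ℝ] V3)
    (hL : ∀ x y z, det3 (L x) (L y) (L z) = det3 x y z) (a b A₀ A₁ A₂ B₀ B₁ B₂ : V3) :
    psiPlusVal (L a) (L b) (L A₀) (L A₁) (L A₂) (L B₀) (L B₁) (L B₂) =
      psiPlusVal a b A₀ A₁ A₂ B₀ B₁ B₂ := by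
  simp only [psiPlusVal, N2, hL, L.norm_map, L.inner_map_map]

theorem psiMinusVal_map (L : V3 ≃ₗᵢ[ℝ] V3)
    (hL : ∀ x y z, det3 (L x) (L y) (L z) = det3 x y z) (a b A₀ A₁ A₂ B₀ B₁ B₂ : V3) :
    psiMinusVal (L a) (L b) (L A₀) (L A₁) (L A₂) (L B₀) (L B₁) (L B₂) =
      psiMinusVal a b A₀ A₁ A₂ B₀ B₁ B₂ := by
  simp only [psiMinusVal, N2, hL, L.norm_map, L.inner_map_map]

theorem rot_map (L : V3 ≃ₗᵢ[ℝ] V3) (a b w z : V3) :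
    rot (L a, L b) (L w, L z) = (L (rot (a, b) (w, z)).1, L (rot (a, b) (w, z)).2) := by
  simp only [rot_apply, rotPart_apply, N2, ContinuousLinearMap.coe_fst',
    ContinuousLinearMap.coe_snd', L.norm_map, L.inner_map_map, map_add, map_sub, map_neg, map_smul]

/-- All ingredients are equivariant under rotations, so the normal form identity carries over. -/
theorem scaledPlus_rot {m : Bivector} (hm : m ∈ smoothLocus) (W Z Y : Bivector) :
    scaledPlus m ![rot m W, Z, Y] = -2 * ‖m.1‖ * ‖m.2‖ * scaledMinus m ![W, Z, Y] := by
  obtain ⟨L, hL, p, s, t, hp, hst, rfl⟩ := exists_normalForm hm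
  obtain ⟨w, rfl⟩ : ∃ w : Bivector, W = (L w.1, L w.2) := ⟨(L.symm W.1, L.symm W.2), by simp⟩
  obtain ⟨z, rfl⟩ : ∃ z : Bivector, Z = (L z.1, L z.2) := ⟨(L.symm Z.1, L.symm Z.2), by simp⟩
  obtain ⟨y, rfl⟩ : ∃ y : Bivector, Y = (L y.1, L y.2) := ⟨(L.symm Y.1, L.symm Y.2), by simp⟩
  have h1 : ‖(!₂[p, 0, 0] : V3)‖ = p := norm_eq_of_sq hp.le (by simp)
  have h2 : ‖(!₂[s ^ 2 - t ^ 2, 2 * s * t, 0] : V3)‖ = s ^ 2 + t ^ 2 :=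
    norm_eq_of_sq hst.le (by simp; ring)
  have key := scaledPlus_rot_normalForm hp hst w z y
  rw [scaledPlus_apply, scaledMinus_apply] at key
  rw [rot_map, scaledPlus_apply, scaledMinus_apply]
  simp only [psiPlusVal_map L hL, psiMinusVal_map L hL, L.norm_map, h1, h2]
  exact key

/-! ### The action of 𝕁 on ψ⁺ and ψ⁻. -/

theorem update_vec3_zero {E : Type*} (x y z a : E) :
    Function.update ![x, y, z] 0 a = ![a, y, z] := by
  ext1 i
  fin_cases i <;> rfl

theorem update_vec3_one {E : Type*} (x y z a : E) :
    Function.update ![x, y, z] 1 a = ![x, a, z] := by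
  ext1 i
  fin_cases i <;> rfl

theorem update_vec3_two {E : Type*} (x y z a : E) :
    Function.update ![x, y, z] 2 a = ![x, y, a] := by
  ext1 i
  fin_cases i <;> rfl

theorem psiPlus_complexStructure {m : Bivector} (hm : m ∈ smoothLocus) (W Z Y : Bivector) :
    psiPlus m ![complexStructure m W, Z, Y] = -psiMinus m ![W, Z, Y] := by
  have h1 := norm_pos_iff.2 hm.1
  have h2 := norm_pos_iff.2 hm.2
  have hN := Real.sqrt_pos.2 (N2_pos hm.1 hm.2)
  have e : scaledPlus m ![complexStructure m W, Z, Y] =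
      (√(N2 m.1 m.2))⁻¹ * scaledPlus m ![rot m W, Z, Y] := by
    have := (scaledPlus m).map_update_smul ![W, Z, Y] 0 (√(N2 m.1 m.2))⁻¹ (rot m W)
    rw [update_vec3_zero, update_vec3_zero, smul_eq_mul] at this
    exact this
  change (8 * ‖m.1‖ * ‖m.2‖)⁻¹ * scaledPlus m _ = -((4 * √(N2 m.1 m.2))⁻¹ * scaledMinus m _)
  -- The factor −2uv, with 1/√N₂ from 𝕁, converts the normalisation 8uv into −4√N₂.
  rw [e, scaledPlus_rot hm]
  field_simp
  ring

/-- Insert 𝕁W into the previous identity and use 𝕁² = −1. -/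
theorem psiMinus_complexStructure {m : Bivector} (hm : m ∈ smoothLocus) (W Z Y : Bivector) :
    psiMinus m ![complexStructure m W, Z, Y] = psiPlus m ![W, Z, Y] := by
  have h := psiPlus_complexStructure hm (complexStructure m W) Z Y
  rw [complexStructure_sq hm] at h
  have e : psiPlus m ![-W, Z, Y] = -psiPlus m ![W, Z, Y] := by
    have := (psiPlus m).toAlternatingMap.map_update_neg ![W, Z, Y] 0 W
    rwa [update_vec3_zero, update_vec3_zero] at this
  linarith

theorem Psi_apply (m : Bivector) (v : Fin 3 → Bivector) :
    Psi m v = psiPlus m v + Complex.I * psiMinus m v := rfl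

/-! ### Linear algebra of forms of type (n, 0). -/

section TypeZero

variable {E : Type*} [NormedAddCommGroup E] [NormedSpace ℝ E] {J : E →L[ℝ] E}

/-- Swapping slots 0 and k changes the sign of both sides. -/
theorem mem_formsOfTypeZero_of_first {n : ℕ} {T : E [⋀^Fin (n + 1)]→L[ℝ] ℂ}
    (h : ∀ v : Fin (n + 1) → E, T (Function.update v 0 (J (v 0))) = Complex.I * T v) :
    T ∈ formsOfTypeZero (n + 1) J := by
  intro v k
  by_cases hk : k = 0
  · subst hk
    exact h v
  · have h1 := h (v ∘ Equiv.swap 0 k)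
    have h2 : Function.update (v ∘ Equiv.swap 0 k) 0 (J ((v ∘ Equiv.swap 0 k) 0)) =
        Function.update v k (J (v k)) ∘ Equiv.swap 0 k := by
      rw [Function.update_comp_equiv]
      simp
    have h3 (w : Fin (n + 1) → E) : T (w ∘ Equiv.swap 0 k) = -T w :=
      T.toAlternatingMap.map_swap w (Ne.symm hk)
    rw [h2, h3, h3] at h1
    linear_combination -h1

theorem apply_update_sum {S : E [⋀^Fin 3]→L[ℝ] ℂ} (w : Fin 3 → E) (k : Fin 3) (c : Fin 3 → ℝ) :
    S (Function.update w k (∑ j, c j • w j)) = c k * S w := by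
  have h : S (Function.update w k (∑ j, c j • w j)) =
      ∑ j, (c j : ℂ) * S (Function.update w k (w j)) := by
    have := S.toAlternatingMap.map_update_sum (t := Finset.univ) k (fun j => c j • w j) w
    refine this.trans (Finset.sum_congr rfl fun j _ => ?_)
    simp
  rw [h, Finset.sum_eq_single k]
  · rw [Function.update_eq_self]
  · intro j _ hj
    have : S (Function.update w k (w j)) = 0 := S.toAlternatingMap.map_update_self w (Ne.symm hj)
    rw [this, mul_zero]
  · simp

theorem apply_update_J {n : ℕ} {S : E [⋀^Fin n]→L[ℝ] ℂ} (hS : S ∈ formsOfTypeZero n J)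
    (w : Fin n → E) (k : Fin n) (y : E) :
    S (Function.update w k (J y)) = Complex.I * S (Function.update w k y) := by
  have := hS (Function.update w k y) k
  simpa using this

/-- Put a vanishing combination of w and Jw into slot k: alternation kills all but the k-th terms,
leaving (g_k + i g'_k) S(w) = 0 with real coefficients. -/
theorem linearIndependent_of_apply_ne_zero {S : E [⋀^Fin 3]→L[ℝ] ℂ}
    (hS : S ∈ formsOfTypeZero 3 J) {w : Fin 3 → E} (hw : S w ≠ 0) :
    LinearIndependent ℝ (Sum.elim w (J ∘ w)) := by
  rw [Fintype.linearIndependent_iff]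
  intro g hg
  rw [Fintype.sum_sum_type] at hg
  simp only [Sum.elim_inl, Sum.elim_inr, Function.comp_apply, ← map_smul, ← map_sum] at hg
  have key (k : Fin 3) : g (Sum.inl k) = 0 ∧ g (Sum.inr k) = 0 := by
    have h1 : S (Function.update w k 0) = 0 := S.map_coord_zero k (by simp)
    rw [← hg, S.map_update_add, apply_update_J hS, apply_update_sum, apply_update_sum] at h1
    have h2 : ((g (Sum.inl k) : ℂ) + Complex.I * g (Sum.inr k)) * S w = 0 := by
      linear_combination h1
    have h3 := (mul_eq_zero.1 h2).resolve_right hw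
    exact ⟨by simpa using congrArg Complex.re h3, by simpa using congrArg Complex.im h3⟩
  rintro (k | k)
  exacts [(key k).1, (key k).2]

/-- In real dimension six the forms of type `(3, 0)` are spanned by any nonzero one. -/
theorem formsOfTypeZero_eq_span (hE : Module.finrank ℝ E = 6) {S : E [⋀^Fin 3]→L[ℝ] ℂ}
    (hS : S ∈ formsOfTypeZero 3 J) (hS0 : S ≠ 0) :
    formsOfTypeZero 3 J = Submodule.span ℂ {S} := by
  obtain ⟨w, hw⟩ : ∃ w, S w ≠ 0 := by
    by_contra! h
    exact hS0 (ContinuousAlternatingMap.ext h)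
  refine le_antisymm (fun T hT => ?_) (Submodule.span_le.2 (by simpa using hS))
  let b := basisOfLinearIndependentOfCardEqFinrank (linearIndependent_of_apply_ne_zero hS hw)
    (by simp [hE])
  have hb : ⇑b = Sum.elim w (J ∘ w) := coe_basisOfLinearIndependentOfCardEqFinrank _ _
  -- The difference U is still of type (3, 0) and vanishes on w. Since w and Jw form a real basis,
  -- pulling each J out as a factor i shows that U = 0.
  have hU : T - (T w / S w) • S ∈ formsOfTypeZero 3 J := sub_mem hT (Submodule.smul_mem _ _ hS)
  have hUw : (T - (T w / S w) • S) w = 0 := by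
    simp [hw]
  generalize hU' : T - (T w / S w) • S = U at hU hUw
  have h0 (σ : Fin 3 → Fin 3) : U (w ∘ σ) = 0 := by
    by_cases h : Function.Injective σ
    · have h1 := U.toAlternatingMap.map_perm w
        (Equiv.ofBijective σ (Finite.injective_iff_bijective.1 h))
      change U (w ∘ σ) = _ • U w at h1
      rw [h1, hUw, smul_zero]
    · exact U.toAlternatingMap.map_eq_zero_of_not_injective _ fun h2 => h h2.of_comp
  have h3 : U = 0 := by
    refine ContinuousAlternatingMap.toAlternatingMap_injective
      (b.ext_alternating fun v _ => ?_)
    change U (fun i => b (v i)) = 0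
    rw [hb]
    have e0 (x y z : E) : U ![J x, y, z] = Complex.I * U ![x, y, z] := by
      simpa only [update_vec3_zero] using apply_update_J hU ![x, y, z] 0 x
    have e1 (x y z : E) : U ![x, J y, z] = Complex.I * U ![x, y, z] := by
      simpa only [update_vec3_one] using apply_update_J hU ![x, y, z] 1 y
    have e2 (x y z : E) : U ![x, y, J z] = Complex.I * U ![x, y, z] := by
      simpa only [update_vec3_two] using apply_update_J hU ![x, y, z] 2 z
    have e3 (i j k : Fin 3) : U ![w i, w j, w k] = 0 := by
      rw [← h0 ![i, j, k]]
      congr 1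
      ext1 l
      fin_cases l <;> rfl
    have e4 : (fun i => Sum.elim w (J ∘ w) (v i)) = ![Sum.elim w (J ∘ w) (v 0),
        Sum.elim w (J ∘ w) (v 1), Sum.elim w (J ∘ w) (v 2)] := by
      ext1 l
      fin_cases l <;> rfl
    rw [e4]
    rcases v 0 with i | i <;> rcases v 1 with j | j <;> rcases v 2 with k | k <;>
      simp [e0, e1, e2, e3]
  rw [h3, sub_eq_zero] at hU'
  exact Submodule.mem_span_singleton.2 ⟨_, hU'.symm⟩

end TypeZero

/-! ### Type and nonvanishing of Ψ. -/

theorem Psi_mem_formsOfTypeZero {m : Bivector} (hm : m ∈ smoothLocus) :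
    Psi m ∈ formsOfTypeZero 3 (complexStructure m) := by
  refine mem_formsOfTypeZero_of_first fun v => ?_
  have h1 : Function.update v 0 (complexStructure m (v 0)) =
      ![complexStructure m (v 0), v 1, v 2] := by
    ext1 i
    fin_cases i <;> rfl
  have h2 : v = ![v 0, v 1, v 2] := by
    ext1 i
    fin_cases i <;> rfl
  rw [h1, Psi_apply, Psi_apply, psiPlus_complexStructure hm, psiMinus_complexStructure hm, ← h2]
  push_cast
  linear_combination -(psiMinus m v : ℂ) * Complex.I_mul_I

/-- On the coordinate vectors of 𝐮 the form 8uv ψ⁺ takes the value v(N₂ + 4v²) > 0. -/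
theorem Psi_ne_zero {m : Bivector} (hm : m ∈ smoothLocus) : Psi m ≠ 0 := by
  intro h
  have h1 := norm_pos_iff.2 hm.1
  have h2 := norm_pos_iff.2 hm.2
  have hN := N2_pos hm.1 hm.2
  have h3 := congrArg (fun T => (T ![(!₂[1, 0, 0], 0), (!₂[0, 1, 0], 0), (!₂[0, 0, 1], 0)]).re) h
  have h4 : psiPlus m ![(!₂[1, 0, 0], 0), (!₂[0, 1, 0], 0), (!₂[0, 0, 1], 0)] = 0 := by
    simpa [Psi_apply] using h3
  change (8 * ‖m.1‖ * ‖m.2‖)⁻¹ * scaledPlus m _ = 0 at h4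
  rw [scaledPlus_apply] at h4
  simp [psiPlusVal, det3, h1.ne', h2.ne'] at h4
  nlinarith

/-! ### Smoothness -/

section Smooth

variable {a b : Bivector → V3} {s : Set Bivector} {m : Bivector}

theorem contDiffWithinAt_dot (ha : ContDiffWithinAt ℝ ∞ a s m) (dB : Fin 3 → Bivector →L[ℝ] ℝ) :
    ContDiffWithinAt ℝ ∞ (fun y => dot (a y) dB) s m :=
  ContDiffWithinAt.sum fun i _ => (contDiffWithinAt_euclidean.1 ha i).smul contDiffWithinAt_const

theorem contDiffWithinAt_triple2 (ha : ContDiffWithinAt ℝ ∞ a s m)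
    (dB dC : Fin 3 → Bivector →L[ℝ] ℝ) :
    ContDiffWithinAt ℝ ∞ (fun y => triple2 (a y) dB dC) s m := by
  refine ContDiffWithinAt.sum fun σ _ => ?_
  simp only [← Int.cast_smul_eq_zsmul ℝ]
  exact ((contDiffWithinAt_euclidean.1 ha (σ 0)).smul contDiffWithinAt_const).const_smul _

theorem contDiffWithinAt_N2 (ha : ContDiffWithinAt ℝ ∞ a s m) (hb : ContDiffWithinAt ℝ ∞ b s m)
    (ha0 : a m ≠ 0) (hb0 : b m ≠ 0) : ContDiffWithinAt ℝ ∞ (fun y => N2 (a y) (b y)) s m :=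
  ((contDiffWithinAt_const.mul (ha.norm ℝ ha0)).mul (hb.norm ℝ hb0)).sub
    (contDiffWithinAt_const.mul (ha.inner ℝ hb))

theorem contDiffWithinAt_psiPlusPart (ha : ContDiffWithinAt ℝ ∞ a s m)
    (hb : ContDiffWithinAt ℝ ∞ b s m) (ha0 : a m ≠ 0) (hb0 : b m ≠ 0)
    (da db : Fin 3 → Bivector →L[ℝ] ℝ) :
    ContDiffWithinAt ℝ ∞ (fun y => psiPlusPart (a y) (b y) da db) s m := by
  have hu := ha.norm ℝ ha0
  have hv := hb.norm ℝ hb0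
  have hN := contDiffWithinAt_N2 ha hb ha0 hb0
  have hr : ContDiffWithinAt ℝ ∞ (fun y => (inner ℝ (a y) (b y) : ℝ)) s m := ha.inner ℝ hb
  have h1 := contDiffWithinAt_dot hb db
  have h2 := contDiffWithinAt_dot ha db
  have h3 := contDiffWithinAt_triple2 ha da da
  have h4 := contDiffWithinAt_triple2 hb da da
  refine ContDiffWithinAt.add (.add (.sub (.smul_const ?_ _) (.smul_const ?_ _))
    (contDiffWithinAt_wedge ?_ h3)) (contDiffWithinAt_wedge ?_ h4) <;> fun_prop

theorem contDiffWithinAt_psiMinusPart (ha : ContDiffWithinAt ℝ ∞ a s m)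
    (hb : ContDiffWithinAt ℝ ∞ b s m) (ha0 : a m ≠ 0) (hb0 : b m ≠ 0)
    (da db : Fin 3 → Bivector →L[ℝ] ℝ) :
    ContDiffWithinAt ℝ ∞ (fun y => psiMinusPart (a y) (b y) da db) s m := by
  have hu := ha.norm ℝ ha0
  have hv := hb.norm ℝ hb0
  have hu' := hu.fun_inv (norm_ne_zero_iff.2 ha0)
  have hv' := hv.fun_inv (norm_ne_zero_iff.2 hb0)
  have hN := contDiffWithinAt_N2 ha hb ha0 hb0
  have hr : ContDiffWithinAt ℝ ∞ (fun y => (inner ℝ (a y) (b y) : ℝ)) s m := ha.inner ℝ hb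
  have h1 := contDiffWithinAt_dot hb db
  have h2 := contDiffWithinAt_dot ha db
  have h3 := contDiffWithinAt_dot hb da
  have h4 := contDiffWithinAt_triple2 ha da da
  have h5 := contDiffWithinAt_triple2 hb db db
  have h6 := contDiffWithinAt_triple2 hb da da
  refine ContDiffWithinAt.add (.add (.add (.add (.smul_const ?_ _) (.smul_const ?_ _))
    (.const_smul _ (contDiffWithinAt_wedge h1 h4))) (.fun_smul ?_ (contDiffWithinAt_wedge h3 h5)))
    (contDiffWithinAt_wedge ?_ h6) <;> fun_prop

theorem contDiffOn_psiPlus : ContDiffOn ℝ ∞ psiPlus smoothLocus := fun m hm => by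
  have ha : ContDiffWithinAt ℝ ∞ (fun y : Bivector => y.1) smoothLocus m := contDiffWithinAt_fst
  have hb : ContDiffWithinAt ℝ ∞ (fun y : Bivector => y.2) smoothLocus m := contDiffWithinAt_snd
  have h1 := norm_ne_zero_iff.2 hm.1
  have h2 := norm_ne_zero_iff.2 hm.2
  refine ContDiffWithinAt.smul (ContDiffWithinAt.fun_inv
    ((contDiffWithinAt_const.mul (ha.norm ℝ hm.1)).mul (hb.norm ℝ hm.2)) (by positivity))
    ((contDiffWithinAt_psiPlusPart ha hb hm.1 hm.2 du dv).add
      (contDiffWithinAt_psiPlusPart hb ha hm.2 hm.1 dv du))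

theorem contDiffOn_psiMinus : ContDiffOn ℝ ∞ psiMinus smoothLocus := fun m hm => by
  have ha : ContDiffWithinAt ℝ ∞ (fun y : Bivector => y.1) smoothLocus m := contDiffWithinAt_fst
  have hb : ContDiffWithinAt ℝ ∞ (fun y : Bivector => y.2) smoothLocus m := contDiffWithinAt_snd
  have hN := N2_pos hm.1 hm.2
  have hN' := Real.sqrt_pos.2 hN
  refine ContDiffWithinAt.smul (ContDiffWithinAt.fun_inv
    (contDiffWithinAt_const.mul ((contDiffWithinAt_N2 ha hb hm.1 hm.2).sqrt hN.ne'))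
    (by positivity)) ((contDiffWithinAt_psiMinusPart ha hb hm.1 hm.2 du dv).sub
      (contDiffWithinAt_psiMinusPart hb ha hm.2 hm.1 dv du))

theorem contDiffOn_Psi : ContDiffOn ℝ ∞ Psi smoothLocus := by
  let L := ContinuousLinearMap.compContinuousAlternatingMapCLM ℝ Bivector ℝ ℂ (Fin 3)
    Complex.ofRealCLM
  have hL : ContDiff ℝ ∞ L := by fun_prop
  exact (hL.comp_contDiffOn contDiffOn_psiPlus).add
    ((hL.comp_contDiffOn contDiffOn_psiMinus).const_smul Complex.I)

/-- A scalar multiple of a smooth nowhere zero form is smooth only if the scalar is. -/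
theorem contDiffOn_of_smul {n : ℕ} {S : Bivector → Bivector [⋀^Fin n]→L[ℝ] ℂ} {f : Bivector → ℂ}
    (hS : ContDiffOn ℝ ∞ S s) (hS0 : ∀ m ∈ s, S m ≠ 0)
    (hf : ContDiffOn ℝ ∞ (fun m => f m • S m) s) : ContDiffOn ℝ ∞ f s := fun m hm => by
  -- With w fixed, S(w) stays nonzero near m within s, and there f is the quotient of two smooth
  -- functions.
  obtain ⟨w, hw⟩ : ∃ w, S m w ≠ 0 := by
    by_contra! h
    exact hS0 m hm (ContinuousAlternatingMap.ext h)
  let L := ContinuousAlternatingMap.apply ℝ Bivector ℂ w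
  have hL : ContDiff ℝ ∞ L := by fun_prop
  have h1 : ContDiffWithinAt ℝ ∞ (fun m => S m w) s m := hL.comp_contDiffWithinAt (hS m hm)
  have h2 : ContDiffWithinAt ℝ ∞ (fun m => f m * S m w) s m := hL.comp_contDiffWithinAt (hf m hm)
  refine (h2.mul (h1.fun_inv hw)).congr_of_eventuallyEq ?_ ?_
  · filter_upwards [h1.continuousWithinAt.eventually_ne hw] with y hy
    rw [mul_assoc, mul_inv_cancel₀ hy, mul_one]
  · rw [mul_assoc, mul_inv_cancel₀ hw, mul_one]

end Smooth

end G2CircleQuotient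

end

open G2CircleQuotient
theorem theorem7p8 :
    (∃ (g : Bivector → Bivector →L[ℝ] Bivector →L[ℝ] ℝ)
        (σ : Bivector → Bivector [⋀^Fin 2]→L[ℝ] ℝ) (J : Bivector → Bivector →L[ℝ] Bivector),
        IsInducedStructure g σ J) ∧
    ∀ (g : Bivector → Bivector →L[ℝ] Bivector →L[ℝ] ℝ)
      (σ : Bivector → Bivector [⋀^Fin 2]→L[ℝ] ℝ) (J : Bivector → Bivector →L[ℝ] Bivector),
      IsInducedStructure g σ J →
        (∀ m ∈ smoothLocus, ∀ W : Bivector, J m (J m W) = -W) ∧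
        (∀ m ∈ smoothLocus,
          Psi m ≠ 0 ∧ formsOfTypeZero 3 (J m) = Submodule.span ℂ {Psi m}) ∧
        ContDiffOn ℝ ∞ Psi smoothLocus ∧
        ∀ T : Bivector → Bivector [⋀^Fin 3]→L[ℝ] ℂ,
          (ContDiffOn ℝ ∞ T smoothLocus ∧ ∀ m ∈ smoothLocus, T m ∈ formsOfTypeZero 3 (J m)) ↔
            ∃ f : Bivector → ℂ, ContDiffOn ℝ ∞ f smoothLocus ∧
              ∀ m ∈ smoothLocus, T m = f m • Psi m := by
  refine ⟨⟨metric, sigma, complexStructure, isInducedStructure⟩, fun g σ J h => ?_⟩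
  have hspan : ∀ m ∈ smoothLocus, formsOfTypeZero 3 (J m) = Submodule.span ℂ {Psi m} := by
    intro m hm
    rw [h.eq_complexStructure hm]
    exact formsOfTypeZero_eq_span (by simp) (Psi_mem_formsOfTypeZero hm) (Psi_ne_zero hm)
  refine ⟨fun m hm W => ?_, fun m hm => ⟨Psi_ne_zero hm, hspan m hm⟩, contDiffOn_Psi, fun T =>
    ⟨?_, ?_⟩⟩
  · rw [h.eq_complexStructure hm]
    exact complexStructure_sq hm W
  · rintro ⟨hT, hT0⟩
    -- The coefficient must be a function on all of ℝ⁶; off the smooth locus its value is immaterial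
    -- and is set to 0.
    have hc (m : Bivector) : ∃ c : ℂ, m ∈ smoothLocus → T m = c • Psi m := by
      by_cases hm : m ∈ smoothLocus
      · have := hT0 m hm
        rw [hspan m hm] at this
        obtain ⟨c, hc⟩ := Submodule.mem_span_singleton.1 this
        exact ⟨c, fun _ => hc.symm⟩
      · exact ⟨0, fun h => absurd h hm⟩
    choose f hf using hc
    exact ⟨f, contDiffOn_of_smul contDiffOn_Psi (fun m => Psi_ne_zero)
      (hT.congr fun m hm => (hf m hm).symm), hf⟩
  · rintro ⟨f, hf, hTf⟩
    refine ⟨(hf.smul contDiffOn_Psi).congr hTf, fun m hm => ?_⟩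
    rw [hspan m hm, hTf m hm]
    exact Submodule.smul_mem _ _ (Submodule.mem_span_singleton_self _)
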